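/- For real numbers $s,t$ with $0<s\le t<1$, let $\hat Q=\hat Q_{s,t}\subset\mathbb R^2$ be the open convex quadrilateral with vertices $\hat A_1=(0,0)$, $\hat A_2=(1,0)$, $\hat A_3=(1-s,s)$, $\hat A_5=(0,t)$; it is the quadrilateral subelement obtained when the reference triangle with vertices $(0,0),(1,0),(0,1)$ is cut along the segment $\hat A_3\hat A_5$. Let $\hat m_1,\hat m_2,\hat m_5$ be the midpoints of the edges $\hat A_1\hat A_2$, $\hat A_2\hat A_3$, $\hat A_5\hat A_1$. Every $\hat v\in H^2(\hat Q)$ has a (unique) representative that is continuous on the closure of $\hat Q$; point values of $\hat v$ are those of this representative. Let $\hat\pi_{\hat Q}\hat v$ be the unique polynomial of degree at most one such that $$\hat\pi_{\hat Q}\hat v(\hat m_1)=\frac{\hat v(\hat A_1)+\hat v(\hat A_2)}2,\qquad \hat\pi_{\hat Q}\hat v(\hat m_2)=\frac{\hat v(\hat A_2)+\hat v(\hat A_3)}2,\qquad \hat\pi_{\hat Q}\hat v(\hat m_5)=\frac{\hat v(\hat A_5)+\hat v(\hat A_1)}2 .$$ Then there is a constant $C>0$, independent of $s$, $t$ and $\hat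 v$, such that for all $0<s\le t<1$ and all $\hat v\in H^2(\hat Q_{s,t})$ $$|\hat v-\hat\pi_{\hat Q}\hat v|_{H^1(\hat Q)}\le C\,|\hat v|_{H^2(\hat Q)},$$ where $|w|_{H^1(\hat Q)}$ and $|w|_{H^2(\hat Q)}$ are the $L^2(\hat Q)$ norms of the weak gradient and of the weak Hessian of $w$. -/

import Mathlib

open MeasureTheory
open scoped ContDiff

noncomputable section

namespace CutElement

/-! ### Sobolev spaces on a plane open set, through weak derivatives -/

/-- `g` is the weak derivative of `v` on the open set `Ω` in the direction `e`:
`∫_Ω v ∂_e φ = - ∫_Ω g φ` for all test functions `φ ∈ C_c^∞(Ω)`. -/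
structure HasWeakDeriv (Ω : Set (ℝ × ℝ)) (e : ℝ × ℝ) (v g : ℝ × ℝ → ℝ) : Prop where
  locInt : LocallyIntegrableOn v Ω volume
  locInt_deriv : LocallyIntegrableOn g Ω volume
  integral_eq : ∀ φ : ℝ × ℝ → ℝ, ContDiff ℝ ∞ φ → HasCompactSupport φ → tsupport φ ⊆ Ω →
    ∫ p in Ω, v p * fderiv ℝ φ p e = -∫ p in Ω, g p * φ p

/-- The weak derivative on an open set is unique up to null sets. -/
theorem HasWeakDeriv.unique {Ω : Set (ℝ × ℝ)} (hΩ : IsOpen Ω) {e : ℝ × ℝ} {v g g' : ℝ × ℝ → ℝ}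
    (h : HasWeakDeriv Ω e v g) (h' : HasWeakDeriv Ω e v g') :
    g =ᵐ[volume.restrict Ω] g' := by
  have key : ∀ φ : ℝ × ℝ → ℝ, ContDiff ℝ ∞ φ → HasCompactSupport φ → tsupport φ ⊆ Ω →
      ∀ f : ℝ × ℝ → ℝ, LocallyIntegrableOn f Ω volume →
        Integrable (fun p => φ p * f p) volume ∧ ∫ p in Ω, f p * φ p = ∫ p, φ p * f p := by
    intro φ hφ hc hs f hf
    have hi : Integrable (fun p => φ p • f p) volume := by
      have h1 : IntegrableOn f (tsupport φ) volume := hf.integrableOn_compact_subset hs hc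
      have h2 : IntegrableOn (fun p => φ p • f p) (tsupport φ) volume :=
        h1.continuousOn_smul hφ.continuous.continuousOn hc
      refine (integrableOn_iff_integrable_of_support_subset ?_).1 h2
      intro p hp
      apply subset_tsupport φ
      intro h0
      exact hp (by simp [h0])
    refine ⟨hi, ?_⟩
    rw [setIntegral_eq_integral_of_forall_compl_eq_zero]
    · simp only [mul_comm]
    · intro p hp
      rw [image_eq_zero_of_notMem_tsupport (fun hq => hp (hs hq)), mul_zero]
  have h0 : ∀ᵐ p ∂(volume : Measure (ℝ × ℝ)), p ∈ Ω → (g - g') p = 0 := by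
    apply hΩ.ae_eq_zero_of_integral_contDiff_smul_eq_zero (h.locInt_deriv.sub h'.locInt_deriv)
    intro φ hφ hc hs
    have e1 := h.integral_eq φ hφ hc hs
    have e2 := h'.integral_eq φ hφ hc hs
    obtain ⟨i1, j1⟩ := key φ hφ hc hs g h.locInt_deriv
    obtain ⟨i2, j2⟩ := key φ hφ hc hs g' h'.locInt_deriv
    simp only [Pi.sub_apply, smul_eq_mul, mul_sub]
    rw [integral_sub i1 i2]
    linarith
  rw [Filter.EventuallyEq, ae_restrict_iff' hΩ.measurableSet]
  filter_upwards [h0] with p hp hq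
  exact sub_eq_zero.1 (hp hq)

/-- `v` has a square integrable weak derivative on `Ω` in the direction `e`. -/
def HasL2WeakDeriv (Ω : Set (ℝ × ℝ)) (e : ℝ × ℝ) (v : ℝ × ℝ → ℝ) : Prop :=
  ∃ g : ℝ × ℝ → ℝ, MemLp g 2 (volume.restrict Ω) ∧ HasWeakDeriv Ω e v g

open Classical in
/-- The square integrable weak derivative of `v` on `Ω` in the direction `e` (a representative of
it; the value `0` is a convention for functions that have none). -/
def weakDeriv (Ω : Set (ℝ × ℝ)) (e : ℝ × ℝ) (v : ℝ × ℝ → ℝ) : ℝ × ℝ → ℝ :=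
  if h : HasL2WeakDeriv Ω e v then h.choose else 0

theorem weakDeriv_spec {Ω : Set (ℝ × ℝ)} {e : ℝ × ℝ} {v : ℝ × ℝ → ℝ}
    (h : HasL2WeakDeriv Ω e v) :
    MemLp (weakDeriv Ω e v) 2 (volume.restrict Ω) ∧ HasWeakDeriv Ω e v (weakDeriv Ω e v) := by
  unfold weakDeriv
  rw [dif_pos h]
  exact h.choose_spec

/-- The coordinate direction `x`. -/
def ex : ℝ × ℝ := (1, 0)

/-- The coordinate direction `y`. -/
def ey : ℝ × ℝ := (0, 1)

/-- `v ∈ H¹(Ω)`: `v` and its first weak derivatives belong to `L²(Ω)`. -/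
def MemH1 (Ω : Set (ℝ × ℝ)) (v : ℝ × ℝ → ℝ) : Prop :=
  MemLp v 2 (volume.restrict Ω) ∧ HasL2WeakDeriv Ω ex v ∧ HasL2WeakDeriv Ω ey v

/-- `v ∈ H²(Ω)`: `v` and its first weak derivatives belong to `H¹(Ω)`. -/
def MemH2 (Ω : Set (ℝ × ℝ)) (v : ℝ × ℝ → ℝ) : Prop :=
  MemH1 Ω v ∧ MemH1 Ω (weakDeriv Ω ex v) ∧ MemH1 Ω (weakDeriv Ω ey v)

/-- The seminorm `|v|_{H¹(Ω)}`, the `L²(Ω)` norm of the weak gradient. -/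
def semiH1 (Ω : Set (ℝ × ℝ)) (v : ℝ × ℝ → ℝ) : ℝ :=
  Real.sqrt (∫ p in Ω, (weakDeriv Ω ex v p ^ 2 + weakDeriv Ω ey v p ^ 2))

/-- The seminorm `|v|_{H²(Ω)}`, the `L²(Ω)` norm of the weak Hessian. -/
def semiH2 (Ω : Set (ℝ × ℝ)) (v : ℝ × ℝ → ℝ) : ℝ :=
  Real.sqrt (∫ p in Ω,
    (weakDeriv Ω ex (weakDeriv Ω ex v) p ^ 2 + weakDeriv Ω ey (weakDeriv Ω ex v) p ^ 2 +
      weakDeriv Ω ex (weakDeriv Ω ey v) p ^ 2 + weakDeriv Ω ey (weakDeriv Ω ey v) p ^ 2))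

/-- `u` is a representative of the class of `v` that is continuous up to the boundary of `Ω`.
The point values of `v` on the closure of `Ω` are those of `u`. -/
def IsContRep (Ω : Set (ℝ × ℝ)) (v u : ℝ × ℝ → ℝ) : Prop :=
  ContinuousOn u (closure Ω) ∧ u =ᵐ[volume.restrict Ω] v

/-! ### The reference quadrilateral -/

/-- The vertices of the reference macro-element with cut parameters `s` and `t`
that are vertices of the quadrilateral subelement. -/
def A1 : ℝ × ℝ := (0, 0)

def A2 : ℝ × ℝ := (1, 0)

def A3 (s : ℝ) : ℝ × ℝ := (1 - s, s)

def A5 (t : ℝ) : ℝ × ℝ := (0, t)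

/-- The (open) quadrilateral subelement with vertices `A1`, `A2`, `A3`, `A5`. -/
def Q (s t : ℝ) : Set (ℝ × ℝ) := interior (convexHull ℝ {A1, A2, A3 s, A5 t})

/-- The midpoints of the edges `A1 A2`, `A2 A3` and `A5 A1`. -/
def m1 : ℝ × ℝ := midpoint ℝ A1 A2

def m2 (s : ℝ) : ℝ × ℝ := midpoint ℝ A2 (A3 s)

def m5 (t : ℝ) : ℝ × ℝ := midpoint ℝ (A5 t) A1

/-- The area of the quadrilateral. -/
def areaQ (s t : ℝ) : ℝ := (t + s - s * t) / 2

/-- The basis functions of the macro-element on the quadrilateral; those that belong to the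
midpoints of the two remaining outer edges vanish on the quadrilateral. -/
def phi1 (s t : ℝ) (p : ℝ × ℝ) : ℝ :=
  ((s - t) * p.1 + (s - 2) * p.2 + t - s * t / 2) / areaQ s t

def phi2 (s t : ℝ) (p : ℝ × ℝ) : ℝ := (t * p.1 + p.2 - t / 2) / areaQ s t

def phi5 (s t : ℝ) (p : ℝ × ℝ) : ℝ := (-s * p.1 + (1 - s) * p.2 + s / 2) / areaQ s t

/-- The vertex-averaging interpolant on the quadrilateral of a function `u` with point values:
the `P₁` function whose value at the midpoint of each of the edges `A1 A2`, `A2 A3`, `A5 A1`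
is the mean of the values of `u` at the endpoints of the edge. -/
def interpQ (s t : ℝ) (u : ℝ × ℝ → ℝ) (p : ℝ × ℝ) : ℝ :=
  (u A1 + u A2) / 2 * phi1 s t p + (u A2 + u (A3 s)) / 2 * phi2 s t p +
    (u (A5 t) + u A1) / 2 * phi5 s t p

/-- The interpolant is the only `P₁` function with the prescribed midpoint values. -/
theorem eq_interpQ_iff {s t : ℝ} (hs : 0 < s) (hst : s ≤ t) (ht : t < 1) (u : ℝ × ℝ → ℝ)
    (a b c : ℝ) :
    (fun p : ℝ × ℝ => a + b * p.1 + c * p.2) = interpQ s t u ↔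
      a + b * m1.1 + c * m1.2 = (u A1 + u A2) / 2 ∧
      a + b * (m2 s).1 + c * (m2 s).2 = (u A2 + u (A3 s)) / 2 ∧
      a + b * (m5 t).1 + c * (m5 t).2 = (u (A5 t) + u A1) / 2 := by
  have hA : areaQ s t ≠ 0 := by
    unfold areaQ
    nlinarith [mul_pos hs (sub_pos.2 ht)]
  have e1 : m1 = (1 / 2, 0) := by
    simp [m1, A1, A2, midpoint_eq_smul_add]
  have e2 : m2 s = (1 - s / 2, s / 2) := by
    simp only [m2, A2, A3, midpoint_eq_smul_add, invOf_eq_inv]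
    ext <;> simp <;> ring
  have e5 : m5 t = (0, t / 2) := by
    simp only [m5, A1, A5, midpoint_eq_smul_add, invOf_eq_inv]
    ext <;> simp <;> ring
  rw [e1, e2, e5]
  constructor
  · intro h
    refine ⟨?_, ?_, ?_⟩
    · have := congrFun h (1 / 2, 0)
      simp only at this ⊢
      rw [this]
      simp only [interpQ, phi1, phi2, phi5]
      field_simp
      unfold areaQ
      ring
    · have := congrFun h (1 - s / 2, s / 2)
      simp only at this ⊢
      rw [this]
      simp only [interpQ, phi1, phi2, phi5]
      field_simp
      unfold areaQ
      ring
    · have := congrFun h (0, t / 2)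
      simp only at this ⊢
      rw [this]
      simp only [interpQ, phi1, phi2, phi5]
      field_simp
      unfold areaQ
      ring
  · rintro ⟨h1, h2, h5⟩
    funext p
    simp only [interpQ, phi1, phi2, phi5]
    rw [← h1, ← h2, ← h5]
    field_simp
    unfold areaQ
    ring

end CutElement

end

noncomputable section

namespace CutElement

open Set Filter Topology
open scoped ENNReal Convolution

/-! ### Elementary inequalities with values in `ℝ≥0∞` -/

/-! The gradient of the interpolant is constant, so two facts suffice: the gradient of `v` is close
to some constant `(b, c)`, and the gradient of the interpolant is close to the same constant. Both
must hold uniformly in the shape of the quadrilateral, which degenerates as `s` and `t` tend to 0.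

The first is a Poincaré inequality on convex sets (`lintegral_lintegral_enorm_sub_sq_le`, then
`HasWeakHessian.exists_lintegral_sub_const_le`). Its constant depends only on the diameter.

For the second, subtract the affine function with gradient `(b, c)` to get `w`, whose full gradient
and Hessian energy is at most 9 times the Hessian energy of `v`. Affine functions are reproduced, so
the remaining gradient error is a combination of the increments of `w` along the edges `A1 A2`, `A2
A3`, `A5 A1`. A trace argument in a triangle on each edge bounds the squared increment by (edge
length)² / (triangle area) times the energy (`enorm_sub_sq_mul_cross_le`). With `T` a multiple of
the energy, the squared increments are at most `T / t`, `s T`, `t T`. Since `s ≤ t`, the large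
increment enters the numerators only with factors of size at most a multiple of `t`, while the
denominator `s + t - s t` is at least `t`. The squared gradient error is thus `O(T / t)`, and the
area of the quadrilateral is at most `t` (`sq_le_of_edge_estimates`).

The inequalities are proved for smooth functions on shrunken convex sets, and passed to weakly
differentiable ones by mollification. The edge estimate also gives Hölder continuity, hence the
continuous representative. -/

theorem _root_.ENNReal.add_sq_le_two_mul (a b : ℝ≥0∞) : (a + b) ^ 2 ≤ 2 * (a ^ 2 + b ^ 2) := by
  rcases eq_or_ne a ⊤ with rfl | ha
  · simp
  rcases eq_or_ne b ⊤ with rfl | hb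
  · simp
  lift a to NNReal using ha
  lift b to NNReal using hb
  exact_mod_cast add_sq_le (a := (a : NNReal)) (b := b)

/-- Cauchy–Schwarz against the constant 1. -/
theorem _root_.MeasureTheory.sq_lintegral_le {α : Type*} [MeasurableSpace α] (μ : Measure α)
    {f : α → ℝ≥0∞} (hf : AEMeasurable f μ) :
    (∫⁻ a, f a ∂μ) ^ 2 ≤ μ univ * ∫⁻ a, f a ^ 2 ∂μ := by
  have h := ENNReal.lintegral_mul_le_Lp_mul_Lq μ Real.HolderConjugate.two_two
    (aemeasurable_const (b := (1 : ℝ≥0∞))) hf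
  simp only [Pi.mul_apply, one_mul, ENNReal.one_rpow, lintegral_const] at h
  have h2 := pow_le_pow_left' h 2
  rw [mul_pow, ← ENNReal.rpow_natCast, ← ENNReal.rpow_natCast, ← ENNReal.rpow_natCast,
    ← ENNReal.rpow_mul, ← ENNReal.rpow_mul] at h2
  simpa using h2

theorem lintegral_comp_const_add_linearMap {G : ℝ × ℝ → ℝ≥0∞} (hG : Measurable G) (p : ℝ × ℝ)
    (L : ℝ × ℝ →ₗ[ℝ] ℝ × ℝ) (hL : LinearMap.det L ≠ 0) :
    ∫⁻ q, G (p + L q) = ENNReal.ofReal |(LinearMap.det L)⁻¹| * ∫⁻ q, G q := by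
  have hLm : Measurable L := L.continuous_of_finiteDimensional.measurable
  have h1 : ∫⁻ q, G (p + L q) = ∫⁻ q, G (p + q) ∂(Measure.map L volume) :=
    (lintegral_map (f := fun q => G (p + q)) (by fun_prop) hLm).symm
  rw [h1, Measure.map_linearMap_addHaar_eq_smul_addHaar volume hL, lintegral_smul_measure,
    lintegral_add_left_eq_self, smul_eq_mul]

/-! ### Estimates for differentiable functions -/

/-- The linear form with coefficients `a` and `b`. -/
def linForm (a b : ℝ) : ℝ × ℝ →L[ℝ] ℝ :=
  a • ContinuousLinearMap.fst ℝ ℝ ℝ + b • ContinuousLinearMap.snd ℝ ℝ ℝ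

@[simp]
theorem linForm_apply (a b : ℝ) (p : ℝ × ℝ) : linForm a b p = a * p.1 + b * p.2 := by
  simp [linForm]

theorem enorm_linForm_apply_le (a b : ℝ) (p : ℝ × ℝ) :
    ‖linForm a b p‖ₑ ≤ ‖p‖ₑ * (‖a‖ₑ + ‖b‖ₑ) := by
  have h1 : ‖p.1‖ₑ ≤ ‖p‖ₑ := by
    rw [enorm_le_iff_norm_le]; exact norm_fst_le p
  have h2 : ‖p.2‖ₑ ≤ ‖p‖ₑ := by
    rw [enorm_le_iff_norm_le]; exact norm_snd_le p
  calc ‖linForm a b p‖ₑ ≤ ‖a * p.1‖ₑ + ‖b * p.2‖ₑ := by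
        rw [linForm_apply]; exact enorm_add_le _ _
    _ = ‖a‖ₑ * ‖p.1‖ₑ + ‖b‖ₑ * ‖p.2‖ₑ := by rw [enorm_mul, enorm_mul]
    _ ≤ ‖a‖ₑ * ‖p‖ₑ + ‖b‖ₑ * ‖p‖ₑ := by gcongr
    _ = _ := by ring

/-- The fundamental theorem of calculus along a segment. The candidate partial derivatives are
continuous everywhere, but are derivatives only on the segment: this is the situation of
mollifications, which are differentiated correctly only away from the boundary. -/
theorem enorm_sub_le_lintegral_segment {f g₁ g₂ : ℝ × ℝ → ℝ} (hg₁ : Continuous g₁)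
    (hg₂ : Continuous g₂) (x a : ℝ × ℝ) {r : ℝ} (hr : 0 ≤ r)
    (h : ∀ τ ∈ Icc 0 r, HasFDerivAt f (linForm (g₁ (x + τ • a)) (g₂ (x + τ • a))) (x + τ • a)) :
    ‖f (x + r • a) - f x‖ₑ ≤
      ‖a‖ₑ * ∫⁻ τ in Ioc 0 r, (‖g₁ (x + τ • a)‖ₑ + ‖g₂ (x + τ • a)‖ₑ) := by
  have hc : Continuous fun τ : ℝ => linForm (g₁ (x + τ • a)) (g₂ (x + τ • a)) a := by
    simp only [linForm_apply]; fun_prop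
  have key := intervalIntegral.integral_eq_sub_of_hasDerivAt (a := 0) (b := r)
    (f := fun τ : ℝ => f (x + τ • a))
    (f' := fun τ : ℝ => linForm (g₁ (x + τ • a)) (g₂ (x + τ • a)) a)
    (fun τ hτ => by
      rw [uIcc_of_le hr] at hτ
      have hd : HasDerivAt (fun τ : ℝ => x + τ • a) a τ := by
        simpa using ((hasDerivAt_id τ).smul_const a).const_add x
      exact (h τ hτ).comp_hasDerivAt τ hd)
    (hc.intervalIntegrable _ _)
  simp only [zero_smul, add_zero] at key
  rw [← key, intervalIntegral.integral_of_le hr]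
  refine (enorm_integral_le_lintegral_enorm _).trans ?_
  rw [← lintegral_const_mul _ (by fun_prop)]
  exact lintegral_mono fun τ => enorm_linForm_apply_le _ _ _

/-- The Poincaré inequality on a convex set, for continuously differentiable functions. -/
theorem lintegral_lintegral_enorm_sub_sq_le {U : Set (ℝ × ℝ)} (hU : Convex ℝ U)
    (hUm : MeasurableSet U) (hd : ∀ x ∈ U, ∀ y ∈ U, ‖y - x‖ ≤ 1) {f g₁ g₂ : ℝ × ℝ → ℝ}
    (hg₁ : Continuous g₁) (hg₂ : Continuous g₂)
    (h : ∀ p ∈ U, HasFDerivAt f (linForm (g₁ p) (g₂ p)) p) :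
    ∫⁻ x in U, ∫⁻ y in U, ‖f y - f x‖ₑ ^ 2 ≤
      8 * volume U * ∫⁻ p in U, (‖g₁ p‖ₑ ^ 2 + ‖g₂ p‖ₑ ^ 2) := by
  set H : ℝ × ℝ → ℝ≥0∞ := fun p => ‖g₁ p‖ₑ + ‖g₂ p‖ₑ with hH
  have hHm : Measurable H := by fun_prop
  set G : ℝ × ℝ → ℝ≥0∞ := U.indicator fun p => H p ^ 2 with hG
  have hGm : Measurable G := (hHm.pow_const 2).indicator hUm
  have hGU : ∫⁻ p, G p = ∫⁻ p in U, H p ^ 2 := lintegral_indicator hUm _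
  -- Square the segment bound by Cauchy–Schwarz on an interval of length 1. The indicator in `G`
  -- allows the later changes of variables to run over the whole plane.
  have hpt : ∀ x ∈ U, ∀ y ∈ U, ‖f y - f x‖ₑ ^ 2 ≤ ∫⁻ τ in Ioc (0 : ℝ) 1, G (x + τ • (y - x)) := by
    intro x hx y hy
    have hmem : ∀ τ ∈ Icc (0 : ℝ) 1, x + τ • (y - x) ∈ U := fun τ hτ =>
      hU.add_smul_sub_mem hx hy hτ
    have h1 := enorm_sub_le_lintegral_segment hg₁ hg₂ x (y - x) zero_le_one
      (fun τ hτ => h _ (hmem τ hτ))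
    have h2 : ‖y - x‖ₑ ≤ 1 := by
      rw [← ofReal_norm, ENNReal.ofReal_le_one]; exact hd x hx y hy
    rw [one_smul, add_sub_cancel] at h1
    calc ‖f y - f x‖ₑ ^ 2 ≤ (∫⁻ τ in Ioc (0 : ℝ) 1, H (x + τ • (y - x))) ^ 2 := by
          gcongr
          exact h1.trans (mul_le_of_le_one_left zero_le h2)
      _ ≤ ∫⁻ τ in Ioc (0 : ℝ) 1, H (x + τ • (y - x)) ^ 2 := by
          refine (sq_lintegral_le _ (by fun_prop)).trans ?_
          simp
      _ = _ := by
          refine setLIntegral_congr_fun measurableSet_Ioc fun τ hτ => ?_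
          simp only [hG]
          rw [indicator_of_mem (hmem τ (Ioc_subset_Icc_self hτ))]
  have hscale : ∀ (c : ℝ × ℝ) (r : ℝ), 1 / 2 ≤ r → ∫⁻ q, G (c + r • q) ≤ 4 * ∫⁻ p, G p := by
    intro c r hr
    have hdet : LinearMap.det (r • (LinearMap.id : ℝ × ℝ →ₗ[ℝ] ℝ × ℝ)) = r ^ 2 := by
      rw [LinearMap.det_smul]; simp
    have h1 := lintegral_comp_const_add_linearMap hGm c (r • LinearMap.id)
      (by rw [hdet]; positivity)
    rw [hdet] at h1
    simp only [LinearMap.smul_apply, LinearMap.id_apply] at h1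
    rw [h1]
    gcongr
    rw [show (4 : ℝ≥0∞) = ENNReal.ofReal 4 by simp]
    apply ENNReal.ofReal_le_ofReal
    rw [abs_of_pos (by positivity), inv_le_comm₀ (by positivity) (by norm_num)]
    nlinarith
  -- Substituting in `y` has Jacobian `τ²` and in `x` has Jacobian `(1 - τ)²`. Choosing the better
  -- variable on each half of `[0, 1]` keeps the Jacobian at least `1 / 4`, so nothing blows up at
  -- the endpoints.
  have hB : ∀ τ : ℝ, ∫⁻ x in U, ∫⁻ y in U, G (x + τ • (y - x)) ≤
      volume U * (4 * ∫⁻ p, G p) := by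
    intro τ
    rcases le_total (1 / 2) τ with hτ | hτ
    · calc ∫⁻ x in U, ∫⁻ y in U, G (x + τ • (y - x)) ≤ ∫⁻ x in U, 4 * ∫⁻ p, G p := by
            refine lintegral_mono fun x => (setLIntegral_le_lintegral _ _).trans ?_
            refine le_trans (le_of_eq ?_) (hscale (x - τ • x) τ hτ)
            congr 1; ext y; congr 1; module
        _ = _ := by rw [setLIntegral_const, mul_comm]
    · rw [lintegral_lintegral_swap (by
        apply Measurable.aemeasurable
        exact hGm.comp (f := fun q : (ℝ × ℝ) × (ℝ × ℝ) => q.1 + τ • (q.2 - q.1)) (by fun_prop))]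
      calc ∫⁻ y in U, ∫⁻ x in U, G (x + τ • (y - x)) ≤ ∫⁻ y in U, 4 * ∫⁻ p, G p := by
            refine lintegral_mono fun y => (setLIntegral_le_lintegral _ _).trans ?_
            refine le_trans (le_of_eq ?_) (hscale (τ • y) (1 - τ) (by linarith))
            congr 1; ext x; congr 1; module
        _ = _ := by rw [setLIntegral_const, mul_comm]
  calc ∫⁻ x in U, ∫⁻ y in U, ‖f y - f x‖ₑ ^ 2
      ≤ ∫⁻ x in U, ∫⁻ y in U, ∫⁻ τ in Ioc (0 : ℝ) 1, G (x + τ • (y - x)) :=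
        setLIntegral_mono' hUm fun x hx => setLIntegral_mono' hUm fun y hy => hpt x hx y hy
    _ = ∫⁻ x in U, ∫⁻ τ in Ioc (0 : ℝ) 1, ∫⁻ y in U, G (x + τ • (y - x)) := by
        refine lintegral_congr fun x => ?_
        rw [lintegral_lintegral_swap]
        apply Measurable.aemeasurable
        exact hGm.comp (f := fun q : (ℝ × ℝ) × ℝ => x + q.2 • (q.1 - x)) (by fun_prop)
    _ = ∫⁻ τ in Ioc (0 : ℝ) 1, ∫⁻ x in U, ∫⁻ y in U, G (x + τ • (y - x)) := by
        rw [lintegral_lintegral_swap]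
        apply Measurable.aemeasurable
        refine Measurable.lintegral_prod_right'
          (f := fun q : ((ℝ × ℝ) × ℝ) × (ℝ × ℝ) => G (q.1.1 + q.1.2 • (q.2 - q.1.1))) ?_
        exact hGm.comp (f := fun q : ((ℝ × ℝ) × ℝ) × (ℝ × ℝ) => q.1.1 + q.1.2 • (q.2 - q.1.1))
          (by fun_prop)
    _ ≤ ∫⁻ τ in Ioc (0 : ℝ) 1, volume U * (4 * ∫⁻ p, G p) := lintegral_mono fun τ => hB τ
    _ = 4 * volume U * ∫⁻ p in U, H p ^ 2 := by
        rw [setLIntegral_const, hGU]; simp; ring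
    _ ≤ 4 * volume U * ∫⁻ p in U, 2 * (‖g₁ p‖ₑ ^ 2 + ‖g₂ p‖ₑ ^ 2) := by
        gcongr with p; exact ENNReal.add_sq_le_two_mul _ _
    _ = _ := by
        rw [lintegral_const_mul _ (by fun_prop)]; ring

/-! ### Increments along an edge of a triangle -/

/-- The determinant of two vectors of the plane. -/
def cross (a b : ℝ × ℝ) : ℝ := a.1 * b.2 - a.2 * b.1

/-- The sum of the squares of six functions. -/
def sqSum (g₁ g₂ h₁₁ h₁₂ h₂₁ h₂₂ : ℝ × ℝ → ℝ) (p : ℝ × ℝ) : ℝ≥0∞ :=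
  ‖g₁ p‖ₑ ^ 2 + ‖g₂ p‖ₑ ^ 2 + (‖h₁₁ p‖ₑ ^ 2 + ‖h₁₂ p‖ₑ ^ 2) + (‖h₂₁ p‖ₑ ^ 2 + ‖h₂₂ p‖ₑ ^ 2)

/-- The map `(τ, θ) ↦ x + τ a + θ b` has Jacobian `|cross a b|`. Keeping it as a factor on the left
makes the degenerate case trivial. -/
theorem lintegral_parallelogram_le {G : ℝ × ℝ → ℝ≥0∞} (hG : Measurable G) (x a b : ℝ × ℝ) :
    (∫⁻ τ in Ioc (0 : ℝ) (1 / 2), ∫⁻ θ in Ioc (0 : ℝ) (1 / 2), G (x + τ • a + θ • b)) *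
      ‖cross a b‖ₑ ≤ ∫⁻ p, G p := by
  rcases eq_or_ne (cross a b) 0 with h0 | h0
  · simp [h0]
  set L : ℝ × ℝ →ₗ[ℝ] ℝ × ℝ :=
    (LinearMap.fst ℝ ℝ ℝ).smulRight a + (LinearMap.snd ℝ ℝ ℝ).smulRight b with hL
  have hdet : LinearMap.det L = cross a b := by
    rw [← LinearMap.det_toMatrix (Module.Basis.finTwoProd ℝ), Matrix.det_fin_two]
    simp [LinearMap.toMatrix_apply, hL, cross]
    ring
  have h1 := lintegral_comp_const_add_linearMap hG x L (by rwa [hdet])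
  have hle : ∫⁻ τ in Ioc (0 : ℝ) (1 / 2), ∫⁻ θ in Ioc (0 : ℝ) (1 / 2), G (x + τ • a + θ • b) ≤
      ∫⁻ q, G (x + L q) := by
    rw [Measure.volume_eq_prod, lintegral_prod _ (by
      apply Measurable.aemeasurable
      exact hG.comp (f := fun q => x + L q)
        (measurable_const.add L.continuous_of_finiteDimensional.measurable))]
    refine (setLIntegral_le_lintegral _ _).trans (lintegral_mono fun τ => ?_)
    refine (setLIntegral_le_lintegral _ _).trans (le_of_eq ?_)
    refine lintegral_congr fun θ => ?_
    simp [hL, add_assoc]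
  calc _ ≤ (∫⁻ q, G (x + L q)) * ‖cross a b‖ₑ := by gcongr
    _ = ∫⁻ p, G p := by
      rw [h1, hdet, mul_right_comm, ← ofReal_norm, ← ENNReal.ofReal_mul (abs_nonneg _),
        Real.norm_eq_abs, ← abs_mul, inv_mul_cancel₀ h0]
      simp

/-- A trace inequality: the increment over half an edge is at most the integral of the gradient
along it. Averaging over the transversal direction `b` replaces that line integral by an integral of
gradient and Hessian over a parallelogram, which Cauchy–Schwarz turns into an energy. -/
theorem enorm_sub_half_sq_mul_cross_le {U : Set (ℝ × ℝ)} (hUm : MeasurableSet U)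
    {f g₁ g₂ h₁₁ h₁₂ h₂₁ h₂₂ : ℝ × ℝ → ℝ} (hg₁ : Continuous g₁) (hg₂ : Continuous g₂)
    (hh₁₁ : Continuous h₁₁) (hh₁₂ : Continuous h₁₂) (hh₂₁ : Continuous h₂₁)
    (hh₂₂ : Continuous h₂₂)
    (hf : ∀ p ∈ U, HasFDerivAt f (linForm (g₁ p) (g₂ p)) p)
    (hf₁ : ∀ p ∈ U, HasFDerivAt g₁ (linForm (h₁₁ p) (h₁₂ p)) p)
    (hf₂ : ∀ p ∈ U, HasFDerivAt g₂ (linForm (h₂₁ p) (h₂₂ p)) p)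
    (x a b : ℝ × ℝ) (hb : ‖b‖ ≤ 1)
    (hmem : ∀ τ ∈ Icc (0 : ℝ) (1 / 2), ∀ θ ∈ Icc (0 : ℝ) (1 / 2), x + τ • a + θ • b ∈ U) :
    ‖f (x + (1 / 2 : ℝ) • a) - f x‖ₑ ^ 2 * ‖cross a b‖ₑ ≤
      ‖a‖ₑ ^ 2 * (8 * ∫⁻ p in U, sqSum g₁ g₂ h₁₁ h₁₂ h₂₁ h₂₂ p) := by
  set N : ℝ × ℝ → ℝ≥0∞ := fun p => ‖g₁ p‖ₑ + ‖g₂ p‖ₑ with hN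
  set R : ℝ × ℝ → ℝ≥0∞ := fun p => (‖h₁₁ p‖ₑ + ‖h₁₂ p‖ₑ) + (‖h₂₁ p‖ₑ + ‖h₂₂ p‖ₑ) with hR
  have hNm : Continuous N := by fun_prop
  have hRm : Continuous R := by fun_prop
  have hb' : ‖b‖ₑ ≤ 1 := by rw [← ofReal_norm, ENNReal.ofReal_le_one]; exact hb
  set S : ℝ × ℝ → ℝ≥0∞ := fun p => 2 * (N p + R p) with hS
  have hSm : Measurable S := by fun_prop
  have hvol : volume (Ioc (0 : ℝ) (1 / 2)) = 2⁻¹ := by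
    rw [Real.volume_Ioc]
    rw [sub_zero, ENNReal.ofReal_div_of_pos (by norm_num)]
    simp
  -- the gradient at the foot of a transversal segment
  have hfoot : ∀ τ ∈ Icc (0 : ℝ) (1 / 2),
      N (x + τ • a) ≤ ∫⁻ θ in Ioc (0 : ℝ) (1 / 2), S (x + τ • a + θ • b) := by
    intro τ hτ
    set p := x + τ • a with hp
    have hI : ∀ θ ∈ Ioc (0 : ℝ) (1 / 2),
        N p ≤ N (p + θ • b) + ∫⁻ θ in Ioc (0 : ℝ) (1 / 2), R (p + θ • b) := by
      intro θ hθ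
      have aux : ∀ {g k₁ k₂ : ℝ × ℝ → ℝ}, Continuous k₁ → Continuous k₂ →
          (∀ p ∈ U, HasFDerivAt g (linForm (k₁ p) (k₂ p)) p) →
          ‖g p‖ₑ ≤ ‖g (p + θ • b)‖ₑ +
            ∫⁻ θ in Ioc (0 : ℝ) (1 / 2), (‖k₁ (p + θ • b)‖ₑ + ‖k₂ (p + θ • b)‖ₑ) := by
        intro g k₁ k₂ hk₁ hk₂ hg
        have h1 := enorm_sub_le_lintegral_segment hk₁ hk₂ p b hθ.1.le
          (fun θ' hθ' => hg _ (hmem τ hτ θ' ⟨hθ'.1, hθ'.2.trans hθ.2⟩))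
        calc ‖g p‖ₑ = ‖g (p + θ • b) - (g (p + θ • b) - g p)‖ₑ := by congr 1; ring
          _ ≤ ‖g (p + θ • b)‖ₑ + ‖g (p + θ • b) - g p‖ₑ := enorm_sub_le
          _ ≤ _ := by
            gcongr
            refine h1.trans ((mul_le_of_le_one_left zero_le hb').trans ?_)
            exact lintegral_mono_set (Ioc_subset_Ioc_right hθ.2)
      have e1 := aux hh₁₁ hh₁₂ hf₁
      have e2 := aux hh₂₁ hh₂₂ hf₂
      simp only [hN, hR]
      rw [lintegral_add_left (by fun_prop)]
      refine (add_le_add e1 e2).trans (le_of_eq ?_)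
      ring
    have h2 := setLIntegral_mono' (μ := volume) measurableSet_Ioc hI
    rw [setLIntegral_const, hvol, lintegral_add_left (by fun_prop), setLIntegral_const, hvol] at h2
    -- The transversal segment has parameter length `1 / 2`, hence the 2 in `S`.
    have h3 : N p = 2 * (N p * 2⁻¹) := by
      rw [mul_comm, mul_assoc, ENNReal.inv_mul_cancel (by simp) (by simp), mul_one]
    rw [h3]
    calc 2 * (N p * 2⁻¹) ≤ 2 * ((∫⁻ θ in Ioc (0 : ℝ) (1 / 2), N (p + θ • b)) +
          (∫⁻ θ in Ioc (0 : ℝ) (1 / 2), R (p + θ • b)) * 2⁻¹) := by gcongr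
      _ ≤ 2 * ((∫⁻ θ in Ioc (0 : ℝ) (1 / 2), N (p + θ • b)) +
          (∫⁻ θ in Ioc (0 : ℝ) (1 / 2), R (p + θ • b))) := by
        gcongr
        exact mul_le_of_le_one_right zero_le (by simp)
      _ = _ := by
        simp only [hS]
        rw [lintegral_const_mul _ (by fun_prop),
          lintegral_add_left (f := fun θ => N (p + θ • b)) (by fun_prop)]
  have h1 := enorm_sub_le_lintegral_segment hg₁ hg₂ x a (r := 1 / 2) (by norm_num)
    (fun τ hτ => by
      have := hmem τ hτ 0 (by norm_num)
      rw [zero_smul, add_zero] at this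
      exact hf _ this)
  have h2 : ‖f (x + (1 / 2 : ℝ) • a) - f x‖ₑ ≤ ‖a‖ₑ *
      ∫⁻ τ in Ioc (0 : ℝ) (1 / 2), ∫⁻ θ in Ioc (0 : ℝ) (1 / 2), S (x + τ • a + θ • b) := by
    refine h1.trans ?_
    gcongr 1
    exact setLIntegral_mono' measurableSet_Ioc fun τ hτ => hfoot τ (Ioc_subset_Icc_self hτ)
  set G : ℝ × ℝ → ℝ≥0∞ := U.indicator fun p => S p ^ 2 with hG
  have hGm : Measurable G := (hSm.pow_const 2).indicator hUm
  have h3 : (∫⁻ τ in Ioc (0 : ℝ) (1 / 2), ∫⁻ θ in Ioc (0 : ℝ) (1 / 2), S (x + τ • a + θ • b)) ^ 2 ≤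
      2⁻¹ * (2⁻¹ *
        ∫⁻ τ in Ioc (0 : ℝ) (1 / 2), ∫⁻ θ in Ioc (0 : ℝ) (1 / 2), G (x + τ • a + θ • b)) := by
    refine (sq_lintegral_le _ ?_).trans ?_
    · apply Measurable.aemeasurable
      refine Measurable.lintegral_prod_right' (f := fun q : ℝ × ℝ => S (x + q.1 • a + q.2 • b)) ?_
      fun_prop
    · rw [Measure.restrict_apply_univ, hvol]
      gcongr
      rw [← lintegral_const_mul' _ _ (by simp)]
      refine setLIntegral_mono' measurableSet_Ioc fun τ hτ => ?_
      refine (sq_lintegral_le _ (by fun_prop)).trans ?_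
      rw [Measure.restrict_apply_univ, hvol]
      gcongr 1
      refine setLIntegral_mono' measurableSet_Ioc fun θ hθ => ?_
      simp only [hG]
      rw [indicator_of_mem (hmem τ (Ioc_subset_Icc_self hτ) θ (Ioc_subset_Icc_self hθ))]
  have h4 := lintegral_parallelogram_le hGm x a b
  -- The 4 is the square of the 2 in `S`; it cancels the two factors `1 / 2` from Cauchy–Schwarz in
  -- `τ` and `θ`.
  have h5 : ∫⁻ p, G p ≤ 4 * (8 * ∫⁻ p in U, sqSum g₁ g₂ h₁₁ h₁₂ h₂₁ h₂₂ p) := by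
    rw [hG, lintegral_indicator hUm, ← lintegral_const_mul' _ _ (by simp),
      ← lintegral_const_mul' _ _ (by simp)]
    refine lintegral_mono fun p => ?_
    have e0 := ENNReal.add_sq_le_two_mul (N p) (R p)
    have e1 := ENNReal.add_sq_le_two_mul ‖g₁ p‖ₑ ‖g₂ p‖ₑ
    have e2 := ENNReal.add_sq_le_two_mul (‖h₁₁ p‖ₑ + ‖h₁₂ p‖ₑ) (‖h₂₁ p‖ₑ + ‖h₂₂ p‖ₑ)
    have e3 := ENNReal.add_sq_le_two_mul ‖h₁₁ p‖ₑ ‖h₁₂ p‖ₑ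
    have e4 := ENNReal.add_sq_le_two_mul ‖h₂₁ p‖ₑ ‖h₂₂ p‖ₑ
    simp only [hS, mul_pow]
    rw [show (2 : ℝ≥0∞) ^ 2 = 4 by norm_num]
    gcongr 4 * ?_
    calc (N p + R p) ^ 2 ≤ 2 * (N p ^ 2 + R p ^ 2) := e0
      _ ≤ 2 * (2 * (‖g₁ p‖ₑ ^ 2 + ‖g₂ p‖ₑ ^ 2) +
          2 * (2 * (‖h₁₁ p‖ₑ ^ 2 + ‖h₁₂ p‖ₑ ^ 2) + 2 * (‖h₂₁ p‖ₑ ^ 2 + ‖h₂₂ p‖ₑ ^ 2))) := by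
        gcongr
        exact e2.trans (by gcongr)
      _ = 4 * (‖g₁ p‖ₑ ^ 2 + ‖g₂ p‖ₑ ^ 2) + 8 * ((‖h₁₁ p‖ₑ ^ 2 + ‖h₁₂ p‖ₑ ^ 2) +
          (‖h₂₁ p‖ₑ ^ 2 + ‖h₂₂ p‖ₑ ^ 2)) := by ring
      _ ≤ 8 * (‖g₁ p‖ₑ ^ 2 + ‖g₂ p‖ₑ ^ 2) + 8 * ((‖h₁₁ p‖ₑ ^ 2 + ‖h₁₂ p‖ₑ ^ 2) +
          (‖h₂₁ p‖ₑ ^ 2 + ‖h₂₂ p‖ₑ ^ 2)) := by gcongr; norm_num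
      _ = _ := by simp only [sqSum]; ring
  set I := ∫⁻ τ in Ioc (0 : ℝ) (1 / 2), ∫⁻ θ in Ioc (0 : ℝ) (1 / 2), G (x + τ • a + θ • b)
  set T := 8 * ∫⁻ p in U, sqSum g₁ g₂ h₁₁ h₁₂ h₂₁ h₂₂ p
  have h6 : (2⁻¹ : ℝ≥0∞) * 2⁻¹ * 4 = 1 := by
    rw [show (4 : ℝ≥0∞) = 2 * 2 by norm_num, show (2⁻¹ : ℝ≥0∞) * 2⁻¹ * (2 * 2) =
      (2⁻¹ * 2) * (2⁻¹ * 2) by ring, ENNReal.inv_mul_cancel (by simp) (by simp), mul_one]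
  calc ‖f (x + (1 / 2 : ℝ) • a) - f x‖ₑ ^ 2 * ‖cross a b‖ₑ
      ≤ (‖a‖ₑ ^ 2 * (2⁻¹ * (2⁻¹ * I))) * ‖cross a b‖ₑ := by
        gcongr
        refine (pow_le_pow_left' h2 2).trans ?_
        rw [mul_pow]
        gcongr
    _ = ‖a‖ₑ ^ 2 * (2⁻¹ * 2⁻¹ * (I * ‖cross a b‖ₑ)) := by ring
    _ ≤ ‖a‖ₑ ^ 2 * (2⁻¹ * 2⁻¹ * (4 * T)) := by
        gcongr ‖a‖ₑ ^ 2 * (2⁻¹ * 2⁻¹ * ?_)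
        exact h4.trans h5
    _ = _ := by rw [← mul_assoc (2⁻¹ * 2⁻¹), h6, one_mul]

/-- A Hölder estimate for the increment of a function along an edge of a triangle, with the
explicit dependence on the shape of the triangle. -/
theorem enorm_sub_sq_mul_cross_le {U : Set (ℝ × ℝ)} (hU : Convex ℝ U) (hUm : MeasurableSet U)
    (hd : ∀ x ∈ U, ∀ y ∈ U, ‖y - x‖ ≤ 1)
    {f g₁ g₂ h₁₁ h₁₂ h₂₁ h₂₂ : ℝ × ℝ → ℝ} (hg₁ : Continuous g₁) (hg₂ : Continuous g₂)
    (hh₁₁ : Continuous h₁₁) (hh₁₂ : Continuous h₁₂) (hh₂₁ : Continuous h₂₁)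
    (hh₂₂ : Continuous h₂₂)
    (hf : ∀ p ∈ U, HasFDerivAt f (linForm (g₁ p) (g₂ p)) p)
    (hf₁ : ∀ p ∈ U, HasFDerivAt g₁ (linForm (h₁₁ p) (h₁₂ p)) p)
    (hf₂ : ∀ p ∈ U, HasFDerivAt g₂ (linForm (h₂₁ p) (h₂₂ p)) p)
    {x y z : ℝ × ℝ} (hx : x ∈ U) (hy : y ∈ U) (hz : z ∈ U) :
    ‖f y - f x‖ₑ ^ 2 * ‖cross (y - x) (z - x)‖ₑ ≤
      ‖y - x‖ₑ ^ 2 * (32 * ∫⁻ p in U, sqSum g₁ g₂ h₁₁ h₁₂ h₂₁ h₂₂ p) := by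
  -- The point is the midpoint of `x + 2τ (y - x)` and `x + 2θ (z - x)`. This is why only half of
  -- the edge can be treated from one endpoint.
  have hmem : ∀ x ∈ U, ∀ y ∈ U, ∀ τ ∈ Icc (0 : ℝ) (1 / 2), ∀ θ ∈ Icc (0 : ℝ) (1 / 2),
      x + τ • (y - x) + θ • (z - x) ∈ U := by
    intro x hx y hy τ hτ θ hθ
    have h1 := hU.add_smul_sub_mem hx hy (t := 2 * τ) ⟨by linarith [hτ.1], by linarith [hτ.2]⟩
    have h2 := hU.add_smul_sub_mem hx hz (t := 2 * θ) ⟨by linarith [hθ.1], by linarith [hθ.2]⟩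
    have h3 := hU h1 h2 (a := 1 / 2) (b := 1 / 2) (by norm_num) (by norm_num) (by norm_num)
    convert h3 using 1
    module
  have e1 := enorm_sub_half_sq_mul_cross_le hUm hg₁ hg₂ hh₁₁ hh₁₂ hh₂₁ hh₂₂ hf hf₁ hf₂ x (y - x)
    (z - x) (hd _ hx _ hz) (hmem x hx y hy)
  have e2 := enorm_sub_half_sq_mul_cross_le hUm hg₁ hg₂ hh₁₁ hh₁₂ hh₂₁ hh₂₂ hf hf₁ hf₂ y (x - y)
    (z - y) (hd _ hy _ hz) (hmem y hy x hx)
  -- The two halves of the edge, treated from `x` and from `y`, meet at the midpoint, and both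
  -- crosses are twice the area of the same triangle up to sign. The constant is `32 = 2 (8 + 8)`.
  have hm : y + (1 / 2 : ℝ) • (x - y) = x + (1 / 2 : ℝ) • (y - x) := by module
  have hc : ‖cross (x - y) (z - y)‖ₑ = ‖cross (y - x) (z - x)‖ₑ := by
    rw [← enorm_neg]
    congr 1
    simp only [cross, Prod.fst_sub, Prod.snd_sub]
    ring
  rw [hm, hc, ← enorm_neg (x - y), neg_sub] at e2
  set m := x + (1 / 2 : ℝ) • (y - x)
  set T := ∫⁻ p in U, sqSum g₁ g₂ h₁₁ h₁₂ h₂₁ h₂₂ p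
  calc ‖f y - f x‖ₑ ^ 2 * ‖cross (y - x) (z - x)‖ₑ
      ≤ (2 * (‖f m - f x‖ₑ ^ 2 + ‖f m - f y‖ₑ ^ 2)) * ‖cross (y - x) (z - x)‖ₑ := by
        gcongr
        refine le_trans ?_ (ENNReal.add_sq_le_two_mul _ _)
        gcongr
        calc ‖f y - f x‖ₑ = ‖(f m - f x) - (f m - f y)‖ₑ := by congr 1; ring
          _ ≤ _ := enorm_sub_le
    _ = 2 * (‖f m - f x‖ₑ ^ 2 * ‖cross (y - x) (z - x)‖ₑ +
          ‖f m - f y‖ₑ ^ 2 * ‖cross (y - x) (z - x)‖ₑ) := by ring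
    _ ≤ 2 * (‖y - x‖ₑ ^ 2 * (8 * T) + ‖y - x‖ₑ ^ 2 * (8 * T)) := by gcongr
    _ = _ := by ring

/-! ### Mollification -/

/-- The points of `Ω` at distance at least `2 / (n + 1)` from the complement. -/
def innerSet (Ω : Set (ℝ × ℝ)) (n : ℕ) : Set (ℝ × ℝ) :=
  {x | Metric.ball x (2 / (n + 1 : ℝ)) ⊆ Ω}

theorem innerSet_subset (Ω : Set (ℝ × ℝ)) (n : ℕ) : innerSet Ω n ⊆ Ω :=
  fun _ hx => hx (Metric.mem_ball_self (by positivity))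

theorem isClosed_innerSet (Ω : Set (ℝ × ℝ)) (n : ℕ) : IsClosed (innerSet Ω n) := by
  have h : innerSet Ω n = (Metric.thickening (2 / (n + 1 : ℝ)) Ωᶜ)ᶜ := by
    ext x
    simp only [innerSet, mem_ofPred_eq, mem_compl_iff, Metric.mem_thickening_iff, not_exists,
      not_and, not_lt, subset_def, Metric.mem_ball]
    constructor
    · intro h z hz
      by_contra! hlt
      exact hz (h z (by rwa [dist_comm]))
    · intro h z hz
      by_contra hlt
      have := h z hlt
      rw [dist_comm] at this
      linarith
  rw [h]
  exact Metric.isOpen_thickening.isClosed_compl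

theorem measurableSet_innerSet (Ω : Set (ℝ × ℝ)) (n : ℕ) : MeasurableSet (innerSet Ω n) :=
  (isClosed_innerSet Ω n).measurableSet

/-- A displacement `w` of the convex combination is the same combination of the points displaced by
`w`. Convexity is needed because the smooth estimates are applied on `innerSet`. -/
theorem convex_innerSet {Ω : Set (ℝ × ℝ)} (hΩ : Convex ℝ Ω) (n : ℕ) :
    Convex ℝ (innerSet Ω n) := by
  intro x hx y hy a b ha hb hab z hz
  set w := z - (a • x + b • y) with hw
  have hwn : ‖w‖ < 2 / (n + 1 : ℝ) := by rwa [Metric.mem_ball, dist_eq_norm] at hz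
  have h1 : x + w ∈ Ω := hx (by simpa [Metric.mem_ball, dist_eq_norm] using hwn)
  have h2 : y + w ∈ Ω := hy (by simpa [Metric.mem_ball, dist_eq_norm] using hwn)
  have h3 := hΩ h1 h2 ha hb hab
  have h4 : a • (x + w) + b • (y + w) = z := by
    have : a • (x + w) + b • (y + w) = (a • x + b • y) + (a + b) • w := by module
    rw [this, hab, hw]
    module
  rwa [h4] at h3

theorem eventually_mem_innerSet {Ω : Set (ℝ × ℝ)} (hΩ : IsOpen Ω) {x : ℝ × ℝ} (hx : x ∈ Ω) :
    ∀ᶠ n : ℕ in atTop, x ∈ innerSet Ω n := by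
  obtain ⟨ε, hε, hb⟩ := Metric.isOpen_iff.1 hΩ x hx
  have h : Tendsto (fun n : ℕ => 2 / (n + 1 : ℝ)) atTop (𝓝 0) := by
    simpa [div_eq_mul_inv] using (tendsto_one_div_add_atTop_nhds_zero_nat (𝕜 := ℝ)).const_mul 2
  filter_upwards [h.eventually (gt_mem_nhds hε)] with n hn
  exact (Metric.ball_subset_ball hn.le).trans hb

/-- A bump function supported in the ball of radius `1 / (n + 1)`. -/
def bump (n : ℕ) : ContDiffBump (0 : ℝ × ℝ) where
  rIn := 1 / (2 * (n + 1 : ℝ))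
  rOut := 1 / (n + 1 : ℝ)
  rIn_pos := by positivity
  rIn_lt_rOut := one_div_lt_one_div_of_lt (by positivity) (by linarith [n.cast_nonneg (α := ℝ)])

/-- The mollification of a function at scale `1 / (n + 1)`. -/
def mollify (n : ℕ) (f : ℝ × ℝ → ℝ) : ℝ × ℝ → ℝ :=
  (bump n).normed volume ⋆[ContinuousLinearMap.lsmul ℝ ℝ, volume] f

theorem continuous_mollify (n : ℕ) {f : ℝ × ℝ → ℝ} (hf : LocallyIntegrable f volume) :
    Continuous (mollify n f) :=
  HasCompactSupport.continuous_convolution_left _ (bump n).hasCompactSupport_normed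
    (bump n).continuous_normed hf

theorem ae_tendsto_mollify {f : ℝ × ℝ → ℝ} (hf : LocallyIntegrable f volume) :
    ∀ᵐ x, Tendsto (fun n => mollify n f x) atTop (𝓝 (f x)) := by
  -- `K = 2` is the ratio of the outer to the inner radius of `bump n`, the same for all `n`.
  refine ContDiffBump.ae_convolution_tendsto_right_of_locallyIntegrable (K := 2)
    tendsto_one_div_add_atTop_nhds_zero_nat (Eventually.of_forall fun n => ?_) hf
  simp only [bump]
  field_simp
  rfl

/-- Mollification averages translates of `f` against the probability measure with density the normed
bump. The square of an average is at most the average of the squares; Tonelli and translation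
invariance finish. A measurable representative is used so that the integrand is jointly measurable.
-/
theorem lintegral_enorm_mollify_sq_le (n : ℕ) {f : ℝ × ℝ → ℝ}
    (hf : AEStronglyMeasurable f volume) :
    ∫⁻ x, ‖mollify n f x‖ₑ ^ 2 ≤ ∫⁻ x, ‖f x‖ₑ ^ 2 := by
  set g := hf.mk f with hg
  have hgm : Measurable g := hf.stronglyMeasurable_mk.measurable
  have hfg : f =ᵐ[volume] g := hf.ae_eq_mk
  have hmoll : mollify n f = mollify n g := by
    funext x
    simp only [mollify, convolution_eq_swap]
    refine integral_congr_ae ?_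
    filter_upwards [hfg] with t ht
    rw [ht]
  have hnorm : ∫⁻ x, ‖f x‖ₑ ^ 2 = ∫⁻ x, ‖g x‖ₑ ^ 2 :=
    lintegral_congr_ae (by filter_upwards [hfg] with t ht; rw [ht])
  rw [hmoll, hnorm]
  set ρ : ℝ × ℝ → ℝ := (bump n).normed volume with hρ
  have hρc : Continuous ρ := (bump n).continuous_normed
  set μ : Measure (ℝ × ℝ) := volume.withDensity fun t => ‖ρ t‖ₑ with hμ
  have hμ1 : μ univ = 1 := by
    rw [hμ, withDensity_apply _ MeasurableSet.univ, Measure.restrict_univ]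
    have h1 : ∫⁻ t, ‖ρ t‖ₑ = ENNReal.ofReal (∫ t, ρ t) := by
      rw [ofReal_integral_eq_lintegral_ofReal (bump n).integrable_normed
        (Eventually.of_forall fun t => (bump n).nonneg_normed t)]
      exact lintegral_congr fun t => Real.enorm_of_nonneg ((bump n).nonneg_normed t)
    rw [h1, (bump n).integral_normed, ENNReal.ofReal_one]
  have : IsFiniteMeasure μ := ⟨by rw [hμ1]; exact ENNReal.one_lt_top⟩
  have hpt : ∀ x, ‖mollify n g x‖ₑ ^ 2 ≤ ∫⁻ t, ‖g (x - t)‖ₑ ^ 2 ∂μ := by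
    intro x
    have h1 : ‖mollify n g x‖ₑ ≤ ∫⁻ t, ‖g (x - t)‖ₑ ∂μ := by
      rw [hμ, lintegral_withDensity_eq_lintegral_mul _ (by fun_prop) (by fun_prop)]
      refine (enorm_integral_le_lintegral_enorm _).trans (le_of_eq ?_)
      refine lintegral_congr fun t => ?_
      simp [enorm_mul, hρ]
    calc _ ≤ (∫⁻ t, ‖g (x - t)‖ₑ ∂μ) ^ 2 := by gcongr
      _ ≤ _ := (sq_lintegral_le μ (by fun_prop)).trans (by rw [hμ1, one_mul])
  calc ∫⁻ x, ‖mollify n g x‖ₑ ^ 2 ≤ ∫⁻ x, ∫⁻ t, ‖g (x - t)‖ₑ ^ 2 ∂μ := lintegral_mono hpt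
    _ = ∫⁻ t, ∫⁻ x, ‖g (x - t)‖ₑ ^ 2 ∂volume ∂μ := by
        refine lintegral_lintegral_swap (f := fun x t => ‖g (x - t)‖ₑ ^ 2)
          (Measurable.aemeasurable ?_)
        exact (hgm.comp (f := fun q : (ℝ × ℝ) × (ℝ × ℝ) => q.1 - q.2)
          (by fun_prop)).enorm.pow_const 2
    _ = ∫⁻ t, ∫⁻ x, ‖g x‖ₑ ^ 2 ∂volume ∂μ := by
        refine lintegral_congr fun t => ?_
        exact lintegral_sub_right_eq_self (fun x => ‖g x‖ₑ ^ 2) t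
    _ = _ := by rw [lintegral_const, hμ1, mul_one]

theorem setLIntegral_enorm_mollify_sq_le (n : ℕ) {Ω : Set (ℝ × ℝ)} (hΩ : MeasurableSet Ω)
    {f : ℝ × ℝ → ℝ} (hf : AEStronglyMeasurable f (volume.restrict Ω)) (U : Set (ℝ × ℝ)) :
    ∫⁻ x in U, ‖mollify n (Ω.indicator f) x‖ₑ ^ 2 ≤ ∫⁻ x in Ω, ‖f x‖ₑ ^ 2 := by
  refine (setLIntegral_le_lintegral _ _).trans
    ((lintegral_enorm_mollify_sq_le n ((aestronglyMeasurable_indicator_iff hΩ).2 hf)).trans ?_)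
  rw [← lintegral_indicator hΩ]
  refine lintegral_mono fun x => ?_
  by_cases hx : x ∈ Ω <;> simp [hx]

/-- The derivative falls on the kernel, and `t ↦ ρ (p - t)` is an admissible test function in the
definition of the weak derivative when `p` is in `innerSet Ω n`. The sign from the reflection
cancels the sign from integration by parts. -/
theorem fderiv_mollify_apply {Ω : Set (ℝ × ℝ)} (hΩ : MeasurableSet Ω) {n : ℕ} {e : ℝ × ℝ}
    {v g : ℝ × ℝ → ℝ} (hv : IntegrableOn v Ω) (h : HasWeakDeriv Ω e v g) {p : ℝ × ℝ}
    (hp : p ∈ innerSet Ω n) :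
    fderiv ℝ (mollify n (Ω.indicator v)) p e = mollify n (Ω.indicator g) p := by
  set ρ : ℝ × ℝ → ℝ := (bump n).normed volume with hρ
  have hρd : ContDiff ℝ ∞ ρ := (bump n).contDiff_normed
  have hρs : HasCompactSupport ρ := (bump n).hasCompactSupport_normed
  have hvi : LocallyIntegrable (Ω.indicator v) volume :=
    ((integrable_indicator_iff hΩ).2 hv).locallyIntegrable
  have hd := HasCompactSupport.hasFDerivAt_convolution_left (ContinuousLinearMap.lsmul ℝ ℝ)
    hρs (hρd.of_le (by simp)) hvi p
  set φ : ℝ × ℝ → ℝ := fun t => ρ (p - t) with hφ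
  have hφd : ContDiff ℝ ∞ φ := hρd.comp (contDiff_const.sub contDiff_id)
  have hφsupp : tsupport φ ⊆ Metric.closedBall p (1 / (n + 1 : ℝ)) := by
    refine closure_minimal ?_ Metric.isClosed_closedBall
    intro t ht
    have : p - t ∈ Function.support ρ := ht
    rw [hρ, (bump n).support_normed_eq, Metric.mem_ball, dist_zero_right] at this
    rw [Metric.mem_closedBall, dist_comm, dist_eq_norm]
    exact this.le
  have hφs : HasCompactSupport φ :=
    (isCompact_closedBall p _).of_isClosed_subset (isClosed_tsupport _) hφsupp
  -- The support lies in the closed ball of radius `1 / (n + 1)`; the radius `2 / (n + 1)` in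
  -- `innerSet` leaves room for it.
  have hφΩ : tsupport φ ⊆ Ω := by
    refine hφsupp.trans ((Metric.closedBall_subset_ball ?_).trans hp)
    gcongr
    norm_num
  have hφe : ∀ t, fderiv ℝ φ t e = -fderiv ℝ ρ (p - t) e := by
    intro t
    have h1 : HasFDerivAt (fun t => p - t) (-ContinuousLinearMap.id ℝ (ℝ × ℝ)) t :=
      (hasFDerivAt_id t).const_sub p
    have h2 : HasFDerivAt ρ (fderiv ℝ ρ (p - t)) (p - t) :=
      (hρd.differentiable (by simp) _).hasFDerivAt
    have h3 : HasFDerivAt φ _ t := h2.comp t h1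
    rw [h3.fderiv]
    simp
  have hex := (hρs.fderiv (𝕜 := ℝ)).convolutionExists_left
    ((ContinuousLinearMap.lsmul ℝ ℝ).precompL (ℝ × ℝ)) (hρd.continuous_fderiv (by simp)) hvi p
  have e1 : fderiv ℝ (mollify n (Ω.indicator v)) p e =
      ∫ t, fderiv ℝ ρ (p - t) e * Ω.indicator v t := by
    change fderiv ℝ (ρ ⋆[ContinuousLinearMap.lsmul ℝ ℝ, volume] Ω.indicator v) p e = _
    rw [hd.fderiv, convolution_eq_swap]
    rw [ContinuousLinearMap.integral_apply hex.integrable_swap]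
    rfl
  have e2 : ∫ t, fderiv ℝ ρ (p - t) e * Ω.indicator v t = -∫ t in Ω, v t * fderiv ℝ φ t e := by
    rw [← integral_indicator hΩ, ← integral_neg]
    congr 1
    ext t
    by_cases ht : t ∈ Ω <;> simp [ht, hφe, mul_comm]
  rw [e1, e2, h.integral_eq φ hφd hφs hφΩ, neg_neg]
  simp only [mollify, convolution_eq_swap]
  rw [← integral_indicator hΩ]
  congr 1
  ext t
  by_cases ht : t ∈ Ω <;> simp [ht, hφ, hρ, mul_comm]

theorem hasFDerivAt_mollify {Ω : Set (ℝ × ℝ)} (hΩ : MeasurableSet Ω) {n : ℕ}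
    {v g₁ g₂ : ℝ × ℝ → ℝ} (hv : IntegrableOn v Ω) (h₁ : HasWeakDeriv Ω ex v g₁)
    (h₂ : HasWeakDeriv Ω ey v g₂) {p : ℝ × ℝ} (hp : p ∈ innerSet Ω n) :
    HasFDerivAt (mollify n (Ω.indicator v))
      (linForm (mollify n (Ω.indicator g₁) p) (mollify n (Ω.indicator g₂) p)) p := by
  have hd : DifferentiableAt ℝ (mollify n (Ω.indicator v)) p := by
    have hvi : LocallyIntegrable (Ω.indicator v) volume :=
      ((integrable_indicator_iff hΩ).2 hv).locallyIntegrable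
    exact (HasCompactSupport.hasFDerivAt_convolution_left (ContinuousLinearMap.lsmul ℝ ℝ)
      (bump n).hasCompactSupport_normed (bump n).contDiff_normed hvi p).differentiableAt
  have e1 := fderiv_mollify_apply hΩ hv h₁ hp
  have e2 := fderiv_mollify_apply hΩ hv h₂ hp
  convert hd.hasFDerivAt using 1
  rw [← e1, ← e2]
  ext <;> simp [ex, ey]

/-! ### Estimates for weakly differentiable functions -/

theorem ae_restrict_tendsto_mollify {Ω : Set (ℝ × ℝ)} (hΩ : MeasurableSet Ω) {v : ℝ × ℝ → ℝ}
    (hv : IntegrableOn v Ω) :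
    ∀ᵐ x ∂(volume.restrict Ω),
      Tendsto (fun n => mollify n (Ω.indicator v) x) atTop (𝓝 (v x)) := by
  rw [ae_restrict_iff' hΩ]
  filter_upwards [ae_tendsto_mollify ((integrable_indicator_iff hΩ).2 hv).locallyIntegrable]
    with x hx hxΩ
  rwa [indicator_of_mem hxΩ] at hx

theorem integrableOn_of_memLp_two {Ω : Set (ℝ × ℝ)} (hfin : volume Ω ≠ ⊤) {v : ℝ × ℝ → ℝ}
    (hv : MemLp v 2 (volume.restrict Ω)) : IntegrableOn v Ω := by
  have : IsFiniteMeasure (volume.restrict Ω) := isFiniteMeasure_restrict.2 hfin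
  exact hv.integrable one_le_two

theorem continuous_mollify_indicator {Ω : Set (ℝ × ℝ)} (hΩ : MeasurableSet Ω) {v : ℝ × ℝ → ℝ}
    (hv : IntegrableOn v Ω) (n : ℕ) : Continuous (mollify n (Ω.indicator v)) :=
  continuous_mollify n ((integrable_indicator_iff hΩ).2 hv).locallyIntegrable

/-- The Poincaré inequality on a convex open set. -/
theorem HasWeakDeriv.lintegral_lintegral_enorm_sub_sq_le {Ω : Set (ℝ × ℝ)} (hΩ : IsOpen Ω)
    (hconv : Convex ℝ Ω) (hd : ∀ x ∈ Ω, ∀ y ∈ Ω, ‖y - x‖ ≤ 1) (hfin : volume Ω ≠ ⊤)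
    {v g₁ g₂ : ℝ × ℝ → ℝ} (hv : MemLp v 2 (volume.restrict Ω))
    (hg₁ : MemLp g₁ 2 (volume.restrict Ω)) (hg₂ : MemLp g₂ 2 (volume.restrict Ω))
    (h₁ : HasWeakDeriv Ω ex v g₁) (h₂ : HasWeakDeriv Ω ey v g₂) :
    ∫⁻ x in Ω, ∫⁻ y in Ω, ‖v y - v x‖ₑ ^ 2 ≤
      8 * volume Ω * ∫⁻ p in Ω, (‖g₁ p‖ₑ ^ 2 + ‖g₂ p‖ₑ ^ 2) := by
  have hm := hΩ.measurableSet
  have hvi := integrableOn_of_memLp_two hfin hv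
  have hg₁i := integrableOn_of_memLp_two hfin hg₁
  have hg₂i := integrableOn_of_memLp_two hfin hg₂
  set w : ℕ → ℝ × ℝ → ℝ := fun n => mollify n (Ω.indicator v) with hw
  have hwc : ∀ n, Continuous (w n) := continuous_mollify_indicator hm hvi
  -- Cutting off to `innerSet` keeps only points where the mollified gradient is correct. The
  -- cut-off is eventually inactive at each point of `Ω`, so Fatou's lemma, used in each variable,
  -- recovers the inequality for `v`.
  set F : ℕ → ℝ × ℝ → ℝ × ℝ → ℝ≥0∞ := fun n x y =>
    (innerSet Ω n ×ˢ innerSet Ω n).indicator (fun q => ‖w n q.2 - w n q.1‖ₑ ^ 2) (x, y) with hF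
  have hFm : ∀ n, Measurable (fun q : (ℝ × ℝ) × (ℝ × ℝ) => F n q.1 q.2) := by
    intro n
    have := hwc n
    exact Measurable.indicator (by fun_prop)
      ((measurableSet_innerSet Ω n).prod (measurableSet_innerSet Ω n))
  have hlim : ∀ᵐ x ∂(volume.restrict Ω), ∀ᵐ y ∂(volume.restrict Ω),
      ‖v y - v x‖ₑ ^ 2 = liminf (fun n => F n x y) atTop := by
    filter_upwards [ae_restrict_tendsto_mollify hm hvi, ae_restrict_mem hm] with x hx hxΩ
    filter_upwards [ae_restrict_tendsto_mollify hm hvi, ae_restrict_mem hm] with y hy hyΩ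
    have h1 : Tendsto (fun n => ‖w n y - w n x‖ₑ ^ 2) atTop (𝓝 (‖v y - v x‖ₑ ^ 2)) :=
      ENNReal.Tendsto.pow (hy.sub hx).enorm
    refine (Tendsto.liminf_eq (h1.congr' ?_)).symm
    filter_upwards [eventually_mem_innerSet hΩ hxΩ, eventually_mem_innerSet hΩ hyΩ] with n hn hn'
    simp only [hF]
    rw [indicator_of_mem (mk_mem_prod hn hn')]
  have hbound : ∀ n, ∫⁻ x in Ω, ∫⁻ y in Ω, F n x y ≤
      8 * volume Ω * ∫⁻ p in Ω, (‖g₁ p‖ₑ ^ 2 + ‖g₂ p‖ₑ ^ 2) := by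
    intro n
    have hc₁ := continuous_mollify_indicator hm hg₁i n
    have hc₂ := continuous_mollify_indicator hm hg₂i n
    have hs := innerSet_subset Ω n
    have hmn := measurableSet_innerSet Ω n
    calc ∫⁻ x in Ω, ∫⁻ y in Ω, F n x y ≤ ∫⁻ x, ∫⁻ y, F n x y :=
          (setLIntegral_le_lintegral _ _).trans
            (lintegral_mono fun x => setLIntegral_le_lintegral _ _)
      _ = ∫⁻ x in innerSet Ω n, ∫⁻ y in innerSet Ω n, ‖w n y - w n x‖ₑ ^ 2 := by
          rw [← lintegral_indicator hmn]
          refine lintegral_congr fun x => ?_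
          by_cases hx : x ∈ innerSet Ω n
          · rw [indicator_of_mem hx, ← lintegral_indicator hmn]
            refine lintegral_congr fun y => ?_
            by_cases hy : y ∈ innerSet Ω n <;> simp [hF, hx, hy]
          · simp [hF, hx]
      _ ≤ 8 * volume (innerSet Ω n) * ∫⁻ p in innerSet Ω n,
            (‖mollify n (Ω.indicator g₁) p‖ₑ ^ 2 + ‖mollify n (Ω.indicator g₂) p‖ₑ ^ 2) :=
          CutElement.lintegral_lintegral_enorm_sub_sq_le (convex_innerSet hconv n) hmn
            (fun x hx y hy => hd x (hs hx) y (hs hy)) hc₁ hc₂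
            (fun p hp => hasFDerivAt_mollify hm hvi h₁ h₂ hp)
      _ ≤ _ := by
          rw [lintegral_add_left (by fun_prop),
            lintegral_add_left' (hg₁.1.enorm.pow_const 2)]
          exact mul_le_mul' (mul_le_mul_right (measure_mono hs) _)
            (add_le_add (setLIntegral_enorm_mollify_sq_le n hm hg₁.1 _)
              (setLIntegral_enorm_mollify_sq_le n hm hg₂.1 _))
  calc ∫⁻ x in Ω, ∫⁻ y in Ω, ‖v y - v x‖ₑ ^ 2
      = ∫⁻ x in Ω, ∫⁻ y in Ω, liminf (fun n => F n x y) atTop :=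
        lintegral_congr_ae (hlim.mono fun x hx => lintegral_congr_ae hx)
    _ ≤ ∫⁻ x in Ω, liminf (fun n => ∫⁻ y in Ω, F n x y) atTop :=
        lintegral_mono fun x => lintegral_liminf_le fun n =>
          (hFm n).comp (measurable_const.prodMk measurable_id)
    _ ≤ liminf (fun n => ∫⁻ x in Ω, ∫⁻ y in Ω, F n x y) atTop :=
        lintegral_liminf_le fun n => (hFm n).lintegral_prod_right'
    _ ≤ liminf (fun _ : ℕ => 8 * volume Ω * ∫⁻ p in Ω, (‖g₁ p‖ₑ ^ 2 + ‖g₂ p‖ₑ ^ 2)) atTop :=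
        liminf_le_liminf (Eventually.of_forall hbound)
    _ = _ := liminf_const _

/-! ### Hölder estimate and continuous representative from a weak Hessian -/

/-- A function with square integrable weak derivatives up to order two, together with these
derivatives. -/
structure HasWeakHessian (Ω : Set (ℝ × ℝ)) (v g₁ g₂ h₁₁ h₁₂ h₂₁ h₂₂ : ℝ × ℝ → ℝ) : Prop where
  memLp : MemLp v 2 (volume.restrict Ω)
  memLp_fst : MemLp g₁ 2 (volume.restrict Ω)
  memLp_snd : MemLp g₂ 2 (volume.restrict Ω)
  memLp_fst_fst : MemLp h₁₁ 2 (volume.restrict Ω)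
  memLp_fst_snd : MemLp h₁₂ 2 (volume.restrict Ω)
  memLp_snd_fst : MemLp h₂₁ 2 (volume.restrict Ω)
  memLp_snd_snd : MemLp h₂₂ 2 (volume.restrict Ω)
  deriv_fst : HasWeakDeriv Ω ex v g₁
  deriv_snd : HasWeakDeriv Ω ey v g₂
  deriv_fst_fst : HasWeakDeriv Ω ex g₁ h₁₁
  deriv_fst_snd : HasWeakDeriv Ω ey g₁ h₁₂
  deriv_snd_fst : HasWeakDeriv Ω ex g₂ h₂₁
  deriv_snd_snd : HasWeakDeriv Ω ey g₂ h₂₂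

variable {Ω : Set (ℝ × ℝ)} {v g₁ g₂ h₁₁ h₁₂ h₂₁ h₂₂ : ℝ × ℝ → ℝ}

theorem lintegral_sqSum {μ : Measure (ℝ × ℝ)} (hg₁ : AEStronglyMeasurable g₁ μ)
    (hg₂ : AEStronglyMeasurable g₂ μ) (hh₁₁ : AEStronglyMeasurable h₁₁ μ)
    (hh₁₂ : AEStronglyMeasurable h₁₂ μ) (hh₂₁ : AEStronglyMeasurable h₂₁ μ) :
    ∫⁻ p, sqSum g₁ g₂ h₁₁ h₁₂ h₂₁ h₂₂ p ∂μ =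
      ∫⁻ p, ‖g₁ p‖ₑ ^ 2 ∂μ + ∫⁻ p, ‖g₂ p‖ₑ ^ 2 ∂μ +
        (∫⁻ p, ‖h₁₁ p‖ₑ ^ 2 ∂μ + ∫⁻ p, ‖h₁₂ p‖ₑ ^ 2 ∂μ) +
        (∫⁻ p, ‖h₂₁ p‖ₑ ^ 2 ∂μ + ∫⁻ p, ‖h₂₂ p‖ₑ ^ 2 ∂μ) := by
  have e1 := hg₁.enorm.pow_const 2
  have e2 := hg₂.enorm.pow_const 2
  have e3 := hh₁₁.enorm.pow_const 2
  have e4 := hh₁₂.enorm.pow_const 2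
  have e5 := hh₂₁.enorm.pow_const 2
  have e12 : AEMeasurable (fun p => ‖g₁ p‖ₑ ^ 2 + ‖g₂ p‖ₑ ^ 2) μ := e1.add e2
  have e1234 : AEMeasurable
      (fun p => ‖g₁ p‖ₑ ^ 2 + ‖g₂ p‖ₑ ^ 2 + (‖h₁₁ p‖ₑ ^ 2 + ‖h₁₂ p‖ₑ ^ 2)) μ :=
    e12.add (e3.add e4)
  rw [← lintegral_add_left' e1, ← lintegral_add_left' e3, ← lintegral_add_left' e5,
    ← lintegral_add_left' e12, ← lintegral_add_left' e1234]
  rfl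

theorem lintegral_enorm_sq_lt_top {μ : Measure (ℝ × ℝ)} (hv : MemLp v 2 μ) :
    ∫⁻ p, ‖v p‖ₑ ^ 2 ∂μ < ⊤ := by
  have h := lintegral_rpow_enorm_lt_top_of_eLpNorm_lt_top (by simp) (by simp) hv.2
  simpa using h

theorem HasWeakHessian.lintegral_sqSum_ne_top (h : HasWeakHessian Ω v g₁ g₂ h₁₁ h₁₂ h₂₁ h₂₂) :
    ∫⁻ p in Ω, sqSum g₁ g₂ h₁₁ h₁₂ h₂₁ h₂₂ p ≠ ⊤ := by
  rw [lintegral_sqSum h.memLp_fst.1 h.memLp_snd.1 h.memLp_fst_fst.1 h.memLp_fst_snd.1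
    h.memLp_snd_fst.1]
  simp [(lintegral_enorm_sq_lt_top h.memLp_fst).ne, (lintegral_enorm_sq_lt_top h.memLp_snd).ne,
    (lintegral_enorm_sq_lt_top h.memLp_fst_fst).ne, (lintegral_enorm_sq_lt_top h.memLp_fst_snd).ne,
    (lintegral_enorm_sq_lt_top h.memLp_snd_fst).ne, (lintegral_enorm_sq_lt_top h.memLp_snd_snd).ne]

/-- The Hölder estimate at the points where the mollifications converge. -/
theorem HasWeakHessian.sub_sq_mul_cross_le_of_tendsto
    (h : HasWeakHessian Ω v g₁ g₂ h₁₁ h₁₂ h₂₁ h₂₂) (hΩ : IsOpen Ω)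
    (hconv : Convex ℝ Ω) (hd : ∀ x ∈ Ω, ∀ y ∈ Ω, ‖y - x‖ ≤ 1) (hfin : volume Ω ≠ ⊤)
    {x y z : ℝ × ℝ} (hx : x ∈ Ω) (hy : y ∈ Ω) (hz : z ∈ Ω)
    (hxt : Tendsto (fun n => mollify n (Ω.indicator v) x) atTop (𝓝 (v x)))
    (hyt : Tendsto (fun n => mollify n (Ω.indicator v) y) atTop (𝓝 (v y))) :
    (v y - v x) ^ 2 * |cross (y - x) (z - x)| ≤
      ‖y - x‖ ^ 2 * (32 * (∫⁻ p in Ω, sqSum g₁ g₂ h₁₁ h₁₂ h₂₁ h₂₂ p).toReal) := by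
  have hm := hΩ.measurableSet
  have hi {f : ℝ × ℝ → ℝ} (hf : MemLp f 2 (volume.restrict Ω)) := integrableOn_of_memLp_two hfin hf
  have hc {f : ℝ × ℝ → ℝ} (hf : MemLp f 2 (volume.restrict Ω)) (n : ℕ) :=
    continuous_mollify_indicator hm (hi hf) n
  set T := ∫⁻ p in Ω, sqSum g₁ g₂ h₁₁ h₁₂ h₂₁ h₂₂ p with hT
  have hTtop : T ≠ ⊤ := h.lintegral_sqSum_ne_top
  have hle {f : ℝ × ℝ → ℝ} (hf : MemLp f 2 (volume.restrict Ω)) (n : ℕ) :=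
    setLIntegral_enorm_mollify_sq_le n hm hf.1 (innerSet Ω n)
  -- Mollification does not increase the energies, so the right side is uniform in `n`. Convergence
  -- is needed only at `x` and `y`, since `z` only fixes the triangle.
  have hev : ∀ᶠ n in atTop,
      ‖mollify n (Ω.indicator v) y - mollify n (Ω.indicator v) x‖ₑ ^ 2 *
        ‖cross (y - x) (z - x)‖ₑ ≤ ‖y - x‖ₑ ^ 2 * (32 * T) := by
    filter_upwards [eventually_mem_innerSet hΩ hx, eventually_mem_innerSet hΩ hy,
      eventually_mem_innerSet hΩ hz] with n hxn hyn hzn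
    have hs := innerSet_subset Ω n
    refine (enorm_sub_sq_mul_cross_le (convex_innerSet hconv n) (measurableSet_innerSet Ω n)
      (fun x hx y hy => hd x (hs hx) y (hs hy)) (hc h.memLp_fst n) (hc h.memLp_snd n)
      (hc h.memLp_fst_fst n) (hc h.memLp_fst_snd n) (hc h.memLp_snd_fst n) (hc h.memLp_snd_snd n)
      (fun p hp => hasFDerivAt_mollify hm (hi h.memLp) h.deriv_fst h.deriv_snd hp)
      (fun p hp => hasFDerivAt_mollify hm (hi h.memLp_fst) h.deriv_fst_fst h.deriv_fst_snd hp)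
      (fun p hp => hasFDerivAt_mollify hm (hi h.memLp_snd) h.deriv_snd_fst h.deriv_snd_snd hp)
      hxn hyn hzn).trans ?_
    gcongr
    rw [hT, lintegral_sqSum h.memLp_fst.1 h.memLp_snd.1 h.memLp_fst_fst.1 h.memLp_fst_snd.1
      h.memLp_snd_fst.1, lintegral_sqSum (hc h.memLp_fst n).aestronglyMeasurable
      (hc h.memLp_snd n).aestronglyMeasurable (hc h.memLp_fst_fst n).aestronglyMeasurable
      (hc h.memLp_fst_snd n).aestronglyMeasurable (hc h.memLp_snd_fst n).aestronglyMeasurable]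
    exact add_le_add (add_le_add (add_le_add (hle h.memLp_fst n) (hle h.memLp_snd n))
      (add_le_add (hle h.memLp_fst_fst n) (hle h.memLp_fst_snd n)))
      (add_le_add (hle h.memLp_snd_fst n) (hle h.memLp_snd_snd n))
  have hlim : Tendsto (fun n => ‖mollify n (Ω.indicator v) y - mollify n (Ω.indicator v) x‖ₑ ^ 2 *
      ‖cross (y - x) (z - x)‖ₑ) atTop (𝓝 (‖v y - v x‖ₑ ^ 2 * ‖cross (y - x) (z - x)‖ₑ)) :=
    ENNReal.Tendsto.mul_const (ENNReal.Tendsto.pow (hyt.sub hxt).enorm) (Or.inr (by simp))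
  have key := le_of_tendsto hlim hev
  have key' := ENNReal.toReal_mono (by finiteness) key
  simpa [ENNReal.toReal_mul, ENNReal.toReal_pow, toReal_enorm] using key'

/-- The part of `Ω` outside the closure is open and null, hence empty. -/
theorem subset_closure_of_ae_mem {S : Set (ℝ × ℝ)} (hΩ : IsOpen Ω)
    (hS : ∀ᵐ x ∂(volume.restrict Ω), x ∈ S) : Ω ⊆ closure (Ω ∩ S) := by
  have hnull : volume (Ω \ S) = 0 := by
    rw [ae_restrict_iff' hΩ.measurableSet] at hS
    refine measure_mono_null (fun x hx => ?_) hS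
    exact fun h => hx.2 (h hx.1)
  have hopen : IsOpen (Ω \ closure (Ω ∩ S)) := hΩ.sdiff isClosed_closure
  have h0 : Ω \ closure (Ω ∩ S) = ∅ := by
    refine (hopen.measure_eq_zero_iff volume).1 (measure_mono_null ?_ hnull)
    exact fun x hx => ⟨hx.1, fun hxS => hx.2 (subset_closure ⟨hx.1, hxS⟩)⟩
  exact sdiff_eq_empty.1 h0

/-- The Hölder estimate for a representative that is continuous up to the boundary. -/
theorem HasWeakHessian.sub_sq_mul_cross_le
    (h : HasWeakHessian Ω v g₁ g₂ h₁₁ h₁₂ h₂₁ h₂₂) (hΩ : IsOpen Ω)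
    (hconv : Convex ℝ Ω) (hd : ∀ x ∈ Ω, ∀ y ∈ Ω, ‖y - x‖ ≤ 1) (hfin : volume Ω ≠ ⊤)
    {u : ℝ × ℝ → ℝ} (hu : IsContRep Ω v u)
    {x y z : ℝ × ℝ} (hx : x ∈ closure Ω) (hy : y ∈ closure Ω) (hz : z ∈ closure Ω) :
    (u y - u x) ^ 2 * |cross (y - x) (z - x)| ≤
      ‖y - x‖ ^ 2 * (32 * (∫⁻ p in Ω, sqSum g₁ g₂ h₁₁ h₁₂ h₂₁ h₂₂ p).toReal) := by
  -- The good points are dense and both sides of the estimate are continuous, so it extends to the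
  -- closure.
  set S : Set (ℝ × ℝ) :=
    {x | Tendsto (fun n => mollify n (Ω.indicator v) x) atTop (𝓝 (v x)) ∧ u x = v x} with hSdef
  have hS : ∀ᵐ x ∂(volume.restrict Ω), x ∈ S :=
    (ae_restrict_tendsto_mollify hΩ.measurableSet (integrableOn_of_memLp_two hfin h.memLp)).and hu.2
  have hcl : closure Ω ⊆ closure (Ω ∩ S) :=
    closure_minimal (subset_closure_of_ae_mem hΩ hS) isClosed_closure
  have hseq : ∀ {x}, x ∈ closure Ω → ∃ s : ℕ → ℝ × ℝ, (∀ n, s n ∈ Ω ∩ S) ∧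
      Tendsto s atTop (𝓝 x) ∧ Tendsto (fun n => u (s n)) atTop (𝓝 (u x)) := by
    intro x hx
    obtain ⟨s, hs, hst⟩ := mem_closure_iff_seq_limit.1 (hcl hx)
    refine ⟨s, hs, hst, ?_⟩
    exact (hu.1 x hx).tendsto.comp (tendsto_nhdsWithin_iff.2
      ⟨hst, Eventually.of_forall fun n => subset_closure (hs n).1⟩)
  obtain ⟨a, ha, hat, hau⟩ := hseq hx
  obtain ⟨b, hb, hbt, hbu⟩ := hseq hy
  obtain ⟨c, hc, hct, -⟩ := hseq hz
  have hcont : Continuous fun q : (ℝ × ℝ) × (ℝ × ℝ) => |cross q.1 q.2| := by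
    unfold cross; fun_prop
  refine le_of_tendsto_of_tendsto' (((hbu.sub hau).pow 2).mul
    ((hcont.tendsto (y - x, z - x)).comp ((hbt.sub hat).prodMk_nhds (hct.sub hat))))
    (((hbt.sub hat).norm.pow 2).mul_const _) fun n => ?_
  have key := h.sub_sq_mul_cross_le_of_tendsto hΩ hconv hd hfin (ha n).1 (hb n).1 (hc n).1
    (ha n).2.1 (hb n).2.1
  rw [← (ha n).2.2, ← (hb n).2.2] at key
  exact key

/-- The Sobolev embedding of `H²` into the continuous functions, on a bounded convex open set. -/
theorem HasWeakHessian.exists_isContRep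
    (h : HasWeakHessian Ω v g₁ g₂ h₁₁ h₁₂ h₂₁ h₂₂) (hΩ : IsOpen Ω) (hne : Ω.Nonempty)
    (hconv : Convex ℝ Ω) (hd : ∀ x ∈ Ω, ∀ y ∈ Ω, ‖y - x‖ ≤ 1) (hfin : volume Ω ≠ ⊤) :
    ∃ u, IsContRep Ω v u := by
  set S : Set (ℝ × ℝ) :=
    Ω ∩ {x | Tendsto (fun n => mollify n (Ω.indicator v) x) atTop (𝓝 (v x))} with hSdef
  have hS := ae_restrict_tendsto_mollify hΩ.measurableSet
    (integrableOn_of_memLp_two hfin h.memLp)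
  have hcl : closure Ω ⊆ closure S :=
    closure_minimal (subset_closure_of_ae_mem hΩ hS) isClosed_closure
  set T := 32 * (∫⁻ p in Ω, sqSum g₁ g₂ h₁₁ h₁₂ h₂₁ h₂₂ p).toReal with hT
  have hT0 : 0 ≤ T := by positivity
  obtain ⟨z, hz⟩ := hne
  obtain ⟨δ, hδ, hball⟩ := Metric.isOpen_iff.1 hΩ z hz
  have hz₁ : z + (δ / 2, 0) ∈ Ω := hball (by
    simp [Metric.mem_ball, Prod.norm_def, abs_of_pos hδ]; linarith)
  have hz₂ : z + (0, δ / 2) ∈ Ω := hball (by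
    simp [Metric.mem_ball, Prod.norm_def, abs_of_pos hδ]; linarith)
  -- Hölder continuity with exponent `1 / 2`. A single apex could be collinear with `x` and `y`.
  -- Moving `z` by `δ / 2` in each coordinate direction changes the cross by a component of `y - x`
  -- times `δ / 2`, up to sign, so the three crosses together control `‖y - x‖`.
  have hhold : ∀ x ∈ S, ∀ y ∈ S, (v y - v x) ^ 2 * δ ≤ ‖y - x‖ * (6 * T) := by
    intro x hx y hy
    have key {z' : ℝ × ℝ} (hz' : z' ∈ Ω) :=
      h.sub_sq_mul_cross_le_of_tendsto hΩ hconv hd hfin hx.1 hy.1 hz' hx.2 hy.2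
    have k0 := key hz
    have k1 := key hz₁
    have k2 := key hz₂
    rcases (norm_nonneg (y - x)).eq_or_lt with h0 | hpos
    · have : y = x := by rwa [eq_comm, norm_eq_zero, sub_eq_zero] at h0
      simp [this]
    have hcr : ‖y - x‖ * (δ / 2) ≤ |cross (y - x) (z - x)| + |cross (y - x) (z + (δ / 2, 0) - x)| +
        |cross (y - x) (z + (0, δ / 2) - x)| := by
      have e1 : cross (y - x) (z + (δ / 2, 0) - x) =
          cross (y - x) (z - x) - (y - x).2 * (δ / 2) := by simp [cross]; ring
      have e2 : cross (y - x) (z + (0, δ / 2) - x) =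
          cross (y - x) (z - x) + (y - x).1 * (δ / 2) := by simp [cross]; ring
      have a1 : |(y - x).2| * (δ / 2) ≤ |cross (y - x) (z - x)| +
          |cross (y - x) (z + (δ / 2, 0) - x)| := by
        rw [← abs_of_pos (half_pos hδ), ← abs_mul, abs_of_pos (half_pos hδ),
          show (y - x).2 * (δ / 2) = cross (y - x) (z - x) -
            cross (y - x) (z + (δ / 2, 0) - x) by rw [e1]; ring]
        exact abs_sub _ _
      have a2 : |(y - x).1| * (δ / 2) ≤ |cross (y - x) (z - x)| +
          |cross (y - x) (z + (0, δ / 2) - x)| := by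
        rw [← abs_of_pos (half_pos hδ), ← abs_mul, abs_of_pos (half_pos hδ),
          show (y - x).1 * (δ / 2) = -(cross (y - x) (z - x) -
            cross (y - x) (z + (0, δ / 2) - x)) by rw [e2]; ring, abs_neg]
        exact abs_sub _ _
      have n1 := abs_nonneg (cross (y - x) (z + (δ / 2, 0) - x))
      have n2 := abs_nonneg (cross (y - x) (z + (0, δ / 2) - x))
      rw [Prod.norm_def, Real.norm_eq_abs, Real.norm_eq_abs]
      rcases max_cases |(y - x).1| |(y - x).2| with ⟨hm, -⟩ | ⟨hm, -⟩ <;> rw [hm] <;> linarith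
    have hs : (v y - v x) ^ 2 * (‖y - x‖ * (δ / 2)) ≤ 3 * (‖y - x‖ ^ 2 * T) := by
      calc _ ≤ (v y - v x) ^ 2 * (|cross (y - x) (z - x)| +
            |cross (y - x) (z + (δ / 2, 0) - x)| + |cross (y - x) (z + (0, δ / 2) - x)|) := by
            gcongr
        _ ≤ _ := by linarith
    have hs' : ‖y - x‖ * ((v y - v x) ^ 2 * δ) ≤ ‖y - x‖ * (‖y - x‖ * (6 * T)) := by linarith
    exact le_of_mul_le_mul_left hs' hpos
  have hlim : ∀ x ∈ closure S, ∃ l, Tendsto v (𝓝[S] x) (𝓝 l) := by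
    intro x hx
    have : (𝓝[S] x).NeBot := mem_closure_iff_nhdsWithin_neBot.1 hx
    refine cauchy_map_iff_exists_tendsto.1 (Metric.cauchy_iff.2 ⟨inferInstance, fun ε hε => ?_⟩)
    -- Two points of the ball are at most `2 r` apart, and `2 r * (6 T) < ε² δ`; the added 12 covers
    -- `T = 0`.
    set r := ε ^ 2 * δ / (12 * T + 12) with hr
    have hr0 : 0 < r := by positivity
    refine ⟨v '' (S ∩ Metric.ball x r), image_mem_map (inter_mem_nhdsWithin _
      (Metric.ball_mem_nhds x hr0)), ?_⟩
    rintro _ ⟨a, ⟨haS, ha⟩, rfl⟩ _ ⟨b, ⟨hbS, hb⟩, rfl⟩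
    have h1 := hhold b hbS a haS
    have h2 : ‖a - b‖ ≤ 2 * r := by
      rw [← dist_eq_norm]
      linarith [dist_triangle_right a b x, Metric.mem_ball.1 ha, Metric.mem_ball.1 hb]
    have h3 : (v a - v b) ^ 2 * δ < ε ^ 2 * δ := by
      calc (v a - v b) ^ 2 * δ ≤ 2 * r * (6 * T) := h1.trans (by gcongr)
        _ < r * (12 * T + 12) := by nlinarith
        _ = ε ^ 2 * δ := by rw [hr]; field_simp
    rw [Real.dist_eq]
    exact abs_lt_of_sq_lt_sq (lt_of_mul_lt_mul_right h3 hδ.le) hε.le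
  refine ⟨extendFrom S v, (continuousOn_extendFrom hcl fun x hx => hlim x (hcl hx)), ?_⟩
  filter_upwards [hS, ae_restrict_mem hΩ.measurableSet] with x hx hxΩ
  have hxS : x ∈ S := ⟨hxΩ, hx⟩
  obtain ⟨l, hl⟩ := hlim x (subset_closure hxS)
  rw [extendFrom_eq (subset_closure hxS) hl]
  -- The neighbourhood filter within `S` includes the point `x` itself, so the limit there is `v x`.
  have h1 : Tendsto v (pure x) (𝓝 l) := hl.mono_left (pure_le_nhdsWithin hxS)
  exact tendsto_nhds_unique h1 (tendsto_pure_nhds v x)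

/-! ### Weak derivatives of differences and of smooth functions -/

theorem integrable_mul_of_locallyIntegrableOn {f φ : ℝ × ℝ → ℝ}
    (hf : LocallyIntegrableOn f Ω volume) (hφ : Continuous φ) (hc : HasCompactSupport φ)
    (hs : tsupport φ ⊆ Ω) : Integrable (fun p => f p * φ p) (volume.restrict Ω) := by
  have h1 : IntegrableOn f (tsupport φ) volume := hf.integrableOn_compact_subset hs hc
  have h2 : IntegrableOn (fun p => φ p • f p) (tsupport φ) volume :=
    h1.continuousOn_smul hφ.continuousOn hc
  have h3 : Integrable (fun p => φ p • f p) volume := by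
    refine (integrableOn_iff_integrable_of_support_subset fun p hp => subset_tsupport φ ?_).1 h2
    intro h0
    exact hp (by simp [h0])
  simpa [mul_comm] using h3.restrict

theorem HasWeakDeriv.sub {e : ℝ × ℝ} {w g k : ℝ × ℝ → ℝ} (h : HasWeakDeriv Ω e v g)
    (h' : HasWeakDeriv Ω e w k) : HasWeakDeriv Ω e (fun p => v p - w p) (fun p => g p - k p) where
  locInt := h.locInt.sub h'.locInt
  locInt_deriv := h.locInt_deriv.sub h'.locInt_deriv
  integral_eq φ hφ hc hs := by
    have hφ' : Continuous fun p => fderiv ℝ φ p e :=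
      (hφ.continuous_fderiv (by simp)).clm_apply continuous_const
    have hc' : HasCompactSupport fun p => fderiv ℝ φ p e := hc.fderiv_apply ℝ e
    have hs' : tsupport (fun p => fderiv ℝ φ p e) ⊆ Ω :=
      (tsupport_fderiv_apply_subset ℝ e).trans hs
    simp only [sub_mul]
    rw [integral_sub (integrable_mul_of_locallyIntegrableOn h.locInt hφ' hc' hs')
      (integrable_mul_of_locallyIntegrableOn h'.locInt hφ' hc' hs'),
      integral_sub (integrable_mul_of_locallyIntegrableOn h.locInt_deriv hφ.continuous hc hs)
      (integrable_mul_of_locallyIntegrableOn h'.locInt_deriv hφ.continuous hc hs),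
      h.integral_eq φ hφ hc hs, h'.integral_eq φ hφ hc hs]
    ring

theorem hasWeakDeriv_of_contDiff {f : ℝ × ℝ → ℝ} (hf : ContDiff ℝ ∞ f) (e : ℝ × ℝ) :
    HasWeakDeriv Ω e f (fun p => fderiv ℝ f p e) := by
  have hf' : Continuous fun p => fderiv ℝ f p e :=
    (hf.continuous_fderiv (by simp)).clm_apply continuous_const
  refine ⟨hf.continuous.locallyIntegrable.locallyIntegrableOn _,
    hf'.locallyIntegrable.locallyIntegrableOn _, fun φ hφ hc hs => ?_⟩
  have hφ' : Continuous fun p => fderiv ℝ φ p e :=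
    (hφ.continuous_fderiv (by simp)).clm_apply continuous_const
  have hc' : HasCompactSupport fun p => fderiv ℝ φ p e := hc.fderiv_apply ℝ e
  have key := integral_mul_fderiv_eq_neg_fderiv_mul_of_integrable (μ := (volume : Measure (ℝ × ℝ)))
    (f := f) (g := φ) (v := e)
    ((hf'.mul hφ.continuous).integrable_of_hasCompactSupport hc.mul_left)
    ((hf.continuous.mul hφ').integrable_of_hasCompactSupport hc'.mul_left)
    ((hf.continuous.mul hφ.continuous).integrable_of_hasCompactSupport hc.mul_left)
    (fun x _ => hf.differentiable (by simp) x) (fun x _ => hφ.differentiable (by simp) x)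
  rw [setIntegral_eq_integral_of_forall_compl_eq_zero,
    setIntegral_eq_integral_of_forall_compl_eq_zero, key]
  · intro p hp
    rw [image_eq_zero_of_notMem_tsupport (fun hq => hp (hs hq)), mul_zero]
  · intro p hp
    have : p ∉ tsupport (fun p => fderiv ℝ φ p e) :=
      fun hq => hp (hs (tsupport_fderiv_apply_subset ℝ e hq))
    rw [image_eq_zero_of_notMem_tsupport this, mul_zero]

/-- The affine function with the given coefficients. -/
def affineFun (a b c : ℝ) (p : ℝ × ℝ) : ℝ := a + b * p.1 + c * p.2

theorem contDiff_affineFun (a b c : ℝ) : ContDiff ℝ ∞ (affineFun a b c) := by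
  unfold affineFun; fun_prop

theorem hasWeakDeriv_affineFun (a b c : ℝ) (e : ℝ × ℝ) :
    HasWeakDeriv Ω e (affineFun a b c) (fun _ => b * e.1 + c * e.2) := by
  convert hasWeakDeriv_of_contDiff (contDiff_affineFun a b c) e using 1
  ext p
  have h : HasFDerivAt (affineFun a b c) (linForm b c) p := by
    have := (linForm b c).hasFDerivAt (x := p) |>.const_add a
    refine this.congr_of_eventuallyEq (Eventually.of_forall fun q => ?_)
    simp [affineFun, add_assoc]
  rw [h.fderiv, linForm_apply]

theorem memLp_continuous_restrict {f : ℝ × ℝ → ℝ} (hf : Continuous f)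
    (hb : Bornology.IsBounded Ω) : MemLp f 2 (volume.restrict Ω) := by
  have : IsFiniteMeasure (volume.restrict Ω) := isFiniteMeasure_restrict.2 hb.measure_lt_top.ne
  obtain ⟨C, hC⟩ := hb.isCompact_closure.exists_bound_of_continuousOn hf.continuousOn
  refine MemLp.of_bound hf.aestronglyMeasurable C ?_
  have h0 : MeasurableSet (closure Ω) := isClosed_closure.measurableSet
  refine ae_restrict_of_ae_restrict_of_subset subset_closure ?_
  exact (ae_restrict_mem h0).mono hC

theorem HasWeakHessian.sub_affineFun (h : HasWeakHessian Ω v g₁ g₂ h₁₁ h₁₂ h₂₁ h₂₂)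
    (hb : Bornology.IsBounded Ω) (a b c : ℝ) :
    HasWeakHessian Ω (fun p => v p - affineFun a b c p) (fun p => g₁ p - b) (fun p => g₂ p - c)
      h₁₁ h₁₂ h₂₁ h₂₂ := by
  have hconst : ∀ k : ℝ, ∀ e : ℝ × ℝ, ∀ {f g : ℝ × ℝ → ℝ}, HasWeakDeriv Ω e f g →
      HasWeakDeriv Ω e (fun p => f p - k) g := by
    intro k e f g hfg
    simpa [affineFun] using hfg.sub (hasWeakDeriv_affineFun k 0 0 e)
  exact
    { memLp := h.memLp.sub (memLp_continuous_restrict (contDiff_affineFun a b c).continuous hb)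
      memLp_fst := h.memLp_fst.sub (memLp_continuous_restrict continuous_const hb)
      memLp_snd := h.memLp_snd.sub (memLp_continuous_restrict continuous_const hb)
      memLp_fst_fst := h.memLp_fst_fst
      memLp_fst_snd := h.memLp_fst_snd
      memLp_snd_fst := h.memLp_snd_fst
      memLp_snd_snd := h.memLp_snd_snd
      deriv_fst := by simpa [ex] using h.deriv_fst.sub (hasWeakDeriv_affineFun a b c ex)
      deriv_snd := by simpa [ey] using h.deriv_snd.sub (hasWeakDeriv_affineFun a b c ey)
      deriv_fst_fst := hconst b ex h.deriv_fst_fst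
      deriv_fst_snd := hconst b ey h.deriv_fst_snd
      deriv_snd_fst := hconst c ex h.deriv_snd_fst
      deriv_snd_snd := hconst c ey h.deriv_snd_snd }

theorem IsContRep.sub {u f : ℝ × ℝ → ℝ} (hu : IsContRep Ω v u) (hf : Continuous f) :
    IsContRep Ω (fun p => v p - f p) (fun p => u p - f p) :=
  ⟨hu.1.sub hf.continuousOn, hu.2.mono fun p hp => by simp only [hp]⟩

theorem MemH2.hasWeakHessian (h : MemH2 Ω v) :
    HasWeakHessian Ω v (weakDeriv Ω ex v) (weakDeriv Ω ey v)
      (weakDeriv Ω ex (weakDeriv Ω ex v)) (weakDeriv Ω ey (weakDeriv Ω ex v))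
      (weakDeriv Ω ex (weakDeriv Ω ey v)) (weakDeriv Ω ey (weakDeriv Ω ey v)) where
  memLp := h.1.1
  memLp_fst := h.2.1.1
  memLp_snd := h.2.2.1
  memLp_fst_fst := (weakDeriv_spec h.2.1.2.1).1
  memLp_fst_snd := (weakDeriv_spec h.2.1.2.2).1
  memLp_snd_fst := (weakDeriv_spec h.2.2.2.1).1
  memLp_snd_snd := (weakDeriv_spec h.2.2.2.2).1
  deriv_fst := (weakDeriv_spec h.1.2.1).2
  deriv_snd := (weakDeriv_spec h.1.2.2).2
  deriv_fst_fst := (weakDeriv_spec h.2.1.2.1).2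
  deriv_fst_snd := (weakDeriv_spec h.2.1.2.2).2
  deriv_snd_fst := (weakDeriv_spec h.2.2.2.1).2
  deriv_snd_snd := (weakDeriv_spec h.2.2.2.2).2

/-- The square of the `L²` norm of the Hessian. -/
def hessEnergy (Ω : Set (ℝ × ℝ)) (h₁₁ h₁₂ h₂₁ h₂₂ : ℝ × ℝ → ℝ) : ℝ≥0∞ :=
  (∫⁻ p in Ω, (‖h₁₁ p‖ₑ ^ 2 + ‖h₁₂ p‖ₑ ^ 2)) + ∫⁻ p in Ω, (‖h₂₁ p‖ₑ ^ 2 + ‖h₂₂ p‖ₑ ^ 2)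

theorem HasWeakHessian.hessEnergy_eq (h : HasWeakHessian Ω v g₁ g₂ h₁₁ h₁₂ h₂₁ h₂₂) :
    hessEnergy Ω h₁₁ h₁₂ h₂₁ h₂₂ =
      ((∫⁻ p in Ω, ‖h₁₁ p‖ₑ ^ 2) + ∫⁻ p in Ω, ‖h₁₂ p‖ₑ ^ 2) +
        ((∫⁻ p in Ω, ‖h₂₁ p‖ₑ ^ 2) + ∫⁻ p in Ω, ‖h₂₂ p‖ₑ ^ 2) := by
  rw [hessEnergy, lintegral_add_left' (h.memLp_fst_fst.1.enorm.pow_const 2),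
    lintegral_add_left' (h.memLp_snd_fst.1.enorm.pow_const 2)]

theorem HasWeakHessian.hessEnergy_ne_top (h : HasWeakHessian Ω v g₁ g₂ h₁₁ h₁₂ h₂₁ h₂₂) :
    hessEnergy Ω h₁₁ h₁₂ h₂₁ h₂₂ ≠ ⊤ := by
  rw [h.hessEnergy_eq]
  simp [(lintegral_enorm_sq_lt_top h.memLp_fst_fst).ne,
    (lintegral_enorm_sq_lt_top h.memLp_fst_snd).ne,
    (lintegral_enorm_sq_lt_top h.memLp_snd_fst).ne, (lintegral_enorm_sq_lt_top h.memLp_snd_snd).ne]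

/-- On a convex open set the gradient is close to a constant, in terms of the Hessian. -/
theorem HasWeakHessian.exists_lintegral_sub_const_le
    (h : HasWeakHessian Ω v g₁ g₂ h₁₁ h₁₂ h₂₁ h₂₂) (hΩ : IsOpen Ω) (hne : Ω.Nonempty)
    (hconv : Convex ℝ Ω) (hd : ∀ x ∈ Ω, ∀ y ∈ Ω, ‖y - x‖ ≤ 1) (hfin : volume Ω ≠ ⊤) :
    ∃ b c : ℝ, ∫⁻ p in Ω, (‖g₁ p - b‖ₑ ^ 2 + ‖g₂ p - c‖ₑ ^ 2) ≤
      8 * hessEnergy Ω h₁₁ h₁₂ h₂₁ h₂₂ := by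
  have hpos : volume Ω ≠ 0 := (hΩ.measure_pos volume hne).ne'
  have hmeas : ∀ {g : ℝ × ℝ → ℝ}, MemLp g 2 (volume.restrict Ω) →
      AEMeasurable (fun q : (ℝ × ℝ) × (ℝ × ℝ) => ‖g q.2 - g q.1‖ₑ ^ 2)
        ((volume.restrict Ω).prod (volume.restrict Ω)) := fun hg =>
    (hg.1.comp_snd.sub hg.1.comp_fst).enorm.pow_const 2
  have hm₁ := (hmeas h.memLp_fst).lintegral_prod_right'
  have hm₂ := (hmeas h.memLp_snd).lintegral_prod_right'
  -- The constants are the values of the gradient at one point where the summed deviation is at most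
  -- its average. Dividing by the volume cancels the volume in the Poincaré constant.
  obtain ⟨x, hx, hle⟩ := exists_le_setLAverage hpos hfin (hm₁.add hm₂)
  refine ⟨g₁ x, g₂ x, ?_⟩
  have haesm : ∀ {g : ℝ × ℝ → ℝ}, MemLp g 2 (volume.restrict Ω) →
      AEMeasurable (fun y => ‖g y - g x‖ₑ ^ 2) (volume.restrict Ω) := fun hg =>
    (hg.1.sub aestronglyMeasurable_const).enorm.pow_const 2
  rw [lintegral_add_left' (haesm h.memLp_fst)]
  refine hle.trans ?_
  rw [setLAverage_eq]
  refine ENNReal.div_le_of_le_mul ?_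
  simp only [Pi.add_apply]
  rw [lintegral_add_left' hm₁]
  have e1 := h.deriv_fst_fst.lintegral_lintegral_enorm_sub_sq_le hΩ hconv hd hfin h.memLp_fst
    h.memLp_fst_fst h.memLp_fst_snd h.deriv_fst_snd
  have e2 := h.deriv_snd_fst.lintegral_lintegral_enorm_sub_sq_le hΩ hconv hd hfin h.memLp_snd
    h.memLp_snd_fst h.memLp_snd_snd h.deriv_snd_snd
  refine (add_le_add e1 e2).trans (le_of_eq ?_)
  rw [hessEnergy]
  ring

/-! ### Geometry of the quadrilateral -/

variable {s t : ℝ}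

theorem isOpen_Q : IsOpen (Q s t) := isOpen_interior

theorem convex_Q : Convex ℝ (Q s t) := (convex_convexHull ℝ _).interior

/-- This box provides both the diameter bound 1 in the sup norm and the area bound `t`; its height
is `t` because `s ≤ t`. -/
theorem convexHull_subset_prod (hs : 0 < s) (hst : s ≤ t) (ht : t < 1) :
    convexHull ℝ {A1, A2, A3 s, A5 t} ⊆ Icc (0 : ℝ) 1 ×ˢ Icc (0 : ℝ) t := by
  refine convexHull_min ?_ ((convex_Icc 0 1).prod (convex_Icc 0 t))
  intro p hp
  simp only [mem_insert_iff, mem_singleton_iff] at hp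
  rcases hp with rfl | rfl | rfl | rfl <;> simp [A1, A2, A3, A5] <;> (try constructor) <;>
    (try constructor) <;> linarith

theorem Q_subset_prod (hs : 0 < s) (hst : s ≤ t) (ht : t < 1) :
    Q s t ⊆ Icc (0 : ℝ) 1 ×ˢ Icc (0 : ℝ) t :=
  interior_subset.trans (convexHull_subset_prod hs hst ht)

theorem isBounded_Q (hs : 0 < s) (hst : s ≤ t) (ht : t < 1) : Bornology.IsBounded (Q s t) :=
  (isCompact_Icc.prod isCompact_Icc).isBounded.subset (Q_subset_prod hs hst ht)

theorem norm_sub_le_one_of_mem_Q (hs : 0 < s) (hst : s ≤ t) (ht : t < 1) :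
    ∀ x ∈ Q s t, ∀ y ∈ Q s t, ‖y - x‖ ≤ 1 := by
  intro x hx y hy
  obtain ⟨⟨a1, a2⟩, a3, a4⟩ := Q_subset_prod hs hst ht hx
  obtain ⟨⟨b1, b2⟩, b3, b4⟩ := Q_subset_prod hs hst ht hy
  rw [Prod.norm_def]
  refine max_le ?_ ?_ <;> rw [Real.norm_eq_abs, abs_le] <;>
    simp only [Prod.fst_sub, Prod.snd_sub] <;> constructor <;> linarith

theorem volume_Q_le (hs : 0 < s) (hst : s ≤ t) (ht : t < 1) :
    volume (Q s t) ≤ ENNReal.ofReal t := by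
  refine (measure_mono (Q_subset_prod hs hst ht)).trans ?_
  rw [Measure.volume_eq_prod, Measure.prod_prod, Real.volume_Icc, Real.volume_Icc]
  simp

/-- The open triangle `A1 A2 A5` is contained in the quadrilateral. -/
theorem nonempty_Q (hs : 0 < s) (hst : s ≤ t) : (Q s t).Nonempty := by
  have ht0 : 0 < t := hs.trans_le hst
  have hopen : IsOpen {p : ℝ × ℝ | 0 < p.1 ∧ 0 < p.2 ∧ t * p.1 + p.2 < t} := by
    refine IsOpen.and ?_ (IsOpen.and ?_ ?_) <;> exact isOpen_lt (by fun_prop) (by fun_prop)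
  refine ⟨(1 / 4, t / 4), interior_maximal ?_ hopen ⟨by norm_num, by positivity, ?_⟩⟩
  · rintro p ⟨h1, h2, h3⟩
    have hsub : ({A1, A2, A5 t} : Set (ℝ × ℝ)) ⊆ {A1, A2, A3 s, A5 t} := by
      intro q hq
      simp only [mem_insert_iff, mem_singleton_iff] at hq ⊢
      tauto
    have hv {q : ℝ × ℝ} (hq : q ∈ ({A1, A2, A5 t} : Set (ℝ × ℝ))) :=
      subset_convexHull ℝ _ (hsub hq)
    have hl : 0 < p.2 / t := by positivity
    have hsum : p.1 + p.2 / t < 1 := by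
      have : t * (p.1 + p.2 / t) < t * 1 := by field_simp; linarith
      exact lt_of_mul_lt_mul_left this ht0.le
    -- Project `p` from `A1` onto the segment `A2 A5`, then combine with `A1`.
    have hB := (convex_convexHull ℝ {A1, A2, A3 s, A5 t}) (hv (q := A2) (by simp))
      (hv (q := A5 t) (by simp)) (a := p.1 / (p.1 + p.2 / t)) (b := p.2 / t / (p.1 + p.2 / t))
      (by positivity) (by positivity) (by field_simp)
    have hP := (convex_convexHull ℝ {A1, A2, A3 s, A5 t}) (hv (q := A1) (by simp)) hB
      (a := 1 - (p.1 + p.2 / t)) (b := p.1 + p.2 / t) (by linarith) (by positivity) (by ring)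
    convert hP using 1
    ext <;> simp [A1, A2, A5] <;> field_simp
  · simp only
    linarith

theorem vertex_mem_closure_Q (hs : 0 < s) (hst : s ≤ t) {p : ℝ × ℝ}
    (hp : p ∈ ({A1, A2, A3 s, A5 t} : Set (ℝ × ℝ))) : p ∈ closure (Q s t) := by
  rw [Q, (convex_convexHull ℝ _).closure_interior_eq_closure_of_nonempty_interior
    (nonempty_Q hs hst)]
  exact subset_closure (subset_convexHull ℝ _ hp)

/-! ### The interpolation error -/

/-- The `x` derivative of the interpolant. -/
def interpX (s t : ℝ) (u : ℝ × ℝ → ℝ) : ℝ :=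
  ((u A1 + u A2) / 2 * (s - t) + (u A2 + u (A3 s)) / 2 * t - (u (A5 t) + u A1) / 2 * s) / areaQ s t

/-- The `y` derivative of the interpolant. -/
def interpY (s t : ℝ) (u : ℝ × ℝ → ℝ) : ℝ :=
  ((u A1 + u A2) / 2 * (s - 2) + (u A2 + u (A3 s)) / 2 + (u (A5 t) + u A1) / 2 * (1 - s)) /
    areaQ s t

theorem interpQ_eq_affineFun (s t : ℝ) (u : ℝ × ℝ → ℝ) :
    ∃ a, interpQ s t u = affineFun a (interpX s t u) (interpY s t u) := by
  refine ⟨((u A1 + u A2) / 2 * (t - s * t / 2) - (u A2 + u (A3 s)) / 2 * (t / 2) +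
    (u (A5 t) + u A1) / 2 * (s / 2)) / areaQ s t, ?_⟩
  funext p
  simp only [interpQ, affineFun, phi1, phi2, phi5, interpX, interpY]
  ring

/-- Here `α`, `β`, `γ` are the increments along `A1 A2`, `A2 A3`, `A1 A5`, and `(x, y)` is the
gradient error. The terms of both numerators have squares of order `t T`: `α`, of size `√(T / t)`,
always carries a factor `s` or `t`. The denominator is at least `t`, and `34 = 18 + 16`. -/
theorem sq_le_of_edge_estimates (hs : 0 < s) (hst : s ≤ t) (ht : t < 1) {T α β γ x y : ℝ}
    (hT : 0 ≤ T) (hα : α ^ 2 * t ≤ T) (hβ : β ^ 2 ≤ s * T) (hγ : γ ^ 2 ≤ t * T)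
    (hx : (s + t - s * t) * x = s * (α - γ) + t * (α + β))
    (hy : (s + t - s * t) * y = β + γ + s * (α - γ)) :
    (x ^ 2 + y ^ 2) * t ≤ 34 * T := by
  have ht0 : 0 < t := hs.trans_le hst
  have hJ : t ≤ s + t - s * t := by nlinarith
  have hJ2 : t ^ 2 ≤ (s + t - s * t) ^ 2 := by gcongr
  have hβ' : β ^ 2 ≤ t * T := hβ.trans (by gcongr)
  have hs2 : s ^ 2 ≤ t ^ 2 := by gcongr
  have hsα : s ^ 2 * α ^ 2 ≤ t * T := by
    calc s ^ 2 * α ^ 2 ≤ t ^ 2 * α ^ 2 := by gcongr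
      _ = t * (α ^ 2 * t) := by ring
      _ ≤ t * T := by gcongr
  have hsγ : s ^ 2 * γ ^ 2 ≤ t * T := by
    have : s ^ 2 ≤ 1 := by nlinarith
    nlinarith [sq_nonneg γ]
  have hY : ((s + t - s * t) * y) ^ 2 ≤ 16 * (t * T) := by
    rw [hy]
    nlinarith [sq_nonneg (β - γ), sq_nonneg (β - s * α), sq_nonneg (β + s * γ),
      sq_nonneg (γ - s * α), sq_nonneg (γ + s * γ), sq_nonneg (s * α + s * γ)]
  have hX : ((s + t - s * t) * x) ^ 2 ≤ 18 * (t * T) := by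
    have a1 : ((s + t) * α) ^ 2 ≤ 4 * (t * T) := by
      calc ((s + t) * α) ^ 2 = (s + t) ^ 2 * α ^ 2 := by ring
        _ ≤ (t + t) ^ 2 * α ^ 2 := by gcongr
        _ = 4 * (t * (α ^ 2 * t)) := by ring
        _ ≤ 4 * (t * T) := by gcongr
    have a2 : (t * β) ^ 2 ≤ t * T := by
      have : t ^ 2 ≤ 1 := by nlinarith
      nlinarith [sq_nonneg β]
    have a3 : (s * γ) ^ 2 ≤ t * T := by rw [mul_pow]; exact hsγ
    rw [hx, show s * (α - γ) + t * (α + β) = (s + t) * α + t * β - s * γ by ring]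
    nlinarith [sq_nonneg ((s + t) * α - t * β), sq_nonneg ((s + t) * α + s * γ),
      sq_nonneg (t * β + s * γ)]
  have hfin : t ^ 2 * (x ^ 2 + y ^ 2) ≤ t * (34 * T) := by
    calc t ^ 2 * (x ^ 2 + y ^ 2) ≤ (s + t - s * t) ^ 2 * (x ^ 2 + y ^ 2) := by gcongr
      _ = ((s + t - s * t) * x) ^ 2 + ((s + t - s * t) * y) ^ 2 := by ring
      _ ≤ _ := by linarith
  have h2 : t * ((x ^ 2 + y ^ 2) * t) ≤ t * (34 * T) := by linarith
  exact le_of_mul_le_mul_left h2 ht0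

/-- Triangle inequality through the constant gradient `(b, c)`: `19600 = 2 (8 + 9792)`. -/
theorem HasWeakHessian.lintegral_sub_interp_le
    (h : HasWeakHessian (Q s t) v g₁ g₂ h₁₁ h₁₂ h₂₁ h₂₂) (hs : 0 < s) (hst : s ≤ t) (ht : t < 1)
    {u : ℝ × ℝ → ℝ} (hu : IsContRep (Q s t) v u) :
    ∫⁻ p in Q s t, (‖g₁ p - interpX s t u‖ₑ ^ 2 + ‖g₂ p - interpY s t u‖ₑ ^ 2) ≤
      19600 * hessEnergy (Q s t) h₁₁ h₁₂ h₂₁ h₂₂ := by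
  have ht0 : 0 < t := hs.trans_le hst
  have hd := norm_sub_le_one_of_mem_Q hs hst ht
  have hb := isBounded_Q hs hst ht
  have hvol := volume_Q_le hs hst ht
  have hfin : volume (Q s t) ≠ ⊤ := ne_top_of_le_ne_top (by simp) hvol
  obtain ⟨b, c, hbc⟩ := h.exists_lintegral_sub_const_le isOpen_Q (nonempty_Q hs hst) convex_Q hd hfin
  have hw := h.sub_affineFun hb 0 b c
  have huw := hu.sub (contDiff_affineFun 0 b c).continuous
  have hBeq := h.hessEnergy_eq
  set B := hessEnergy (Q s t) h₁₁ h₁₂ h₂₁ h₂₂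
  have hBtop : B ≠ ⊤ := h.hessEnergy_ne_top
  set E := ∫⁻ p in Q s t, sqSum (fun p => g₁ p - b) (fun p => g₂ p - c) h₁₁ h₁₂ h₂₁ h₂₂ p with hE
  -- 8 from the Poincaré bound for the shifted gradient, 1 from the Hessian itself.
  have hEB : E ≤ 9 * B := by
    rw [hE, lintegral_sqSum hw.memLp_fst.1 hw.memLp_snd.1 hw.memLp_fst_fst.1 hw.memLp_fst_snd.1
      hw.memLp_snd_fst.1, ← lintegral_add_left' (hw.memLp_fst.1.enorm.pow_const 2), add_assoc,
      ← hBeq, show (9 : ℝ≥0∞) * B = 8 * B + B by ring]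
    gcongr
  set T := 32 * E.toReal with hT
  have hT0 : 0 ≤ T := by positivity
  have hTB : T ≤ 288 * B.toReal := by
    have := ENNReal.toReal_mono (by finiteness) hEB
    rw [ENNReal.toReal_mul] at this
    simp only [ENNReal.toReal_ofNat] at this
    linarith
  set w : ℝ × ℝ → ℝ := fun p => u p - affineFun 0 b c p with hwdef
  have hest {x y z : ℝ × ℝ} := hw.sub_sq_mul_cross_le isOpen_Q convex_Q hd hfin huw
    (x := x) (y := y) (z := z)
  have m1 : A1 ∈ closure (Q s t) := vertex_mem_closure_Q hs hst (by simp)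
  have m2 : A2 ∈ closure (Q s t) := vertex_mem_closure_Q hs hst (by simp)
  have m3 : A3 s ∈ closure (Q s t) := vertex_mem_closure_Q hs hst (by simp)
  have m5 : A5 t ∈ closure (Q s t) := vertex_mem_closure_Q hs hst (by simp)
  -- The apexes are `A5`, `A1`, `A2` for the three edges. The crosses have absolute values `t`, `s`,
  -- `t` and the sup-norm lengths are `1`, `s`, `t`.
  have hα : (w A2 - w A1) ^ 2 * t ≤ T := by
    have := hest m1 m2 m5
    simpa [A1, A2, A5, cross, Prod.norm_def, abs_of_pos ht0] using this
  have hβ : (w (A3 s) - w A2) ^ 2 ≤ s * T := by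
    have := hest m2 m3 m1
    have e : (w (A3 s) - w A2) ^ 2 * s ≤ s ^ 2 * T := by
      simpa [A1, A2, A3, cross, Prod.norm_def, abs_of_pos hs] using this
    exact le_of_mul_le_mul_right (by linarith) hs
  have hγ : (w (A5 t) - w A1) ^ 2 ≤ t * T := by
    have := hest m1 m5 m2
    have e : (w (A5 t) - w A1) ^ 2 * t ≤ t ^ 2 * T := by
      simpa [A1, A2, A5, cross, Prod.norm_def, abs_of_pos ht0, max_eq_right ht0.le] using this
    exact le_of_mul_le_mul_right (by linarith) ht0
  have hJ : t + s - s * t ≠ 0 := by nlinarith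
  have hx : (s + t - s * t) * (interpX s t u - b) =
      s * ((w A2 - w A1) - (w (A5 t) - w A1)) + t * ((w A2 - w A1) + (w (A3 s) - w A2)) := by
    simp only [hwdef, interpX, areaQ, affineFun, A1, A2, A3, A5]
    field_simp
    ring
  have hy : (s + t - s * t) * (interpY s t u - c) =
      (w (A3 s) - w A2) + (w (A5 t) - w A1) + s * ((w A2 - w A1) - (w (A5 t) - w A1)) := by
    simp only [hwdef, interpY, areaQ, affineFun, A1, A2, A3, A5]
    field_simp
    ring
  have hxy := sq_le_of_edge_estimates hs hst ht hT0 hα hβ hγ hx hy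
  set x := interpX s t u - b with hxdef
  set y := interpY s t u - c with hydef
  -- The area bound `t` absorbs the blow-up `1 / t` of the squared gradient error; `9792 = 34 *
  -- 288`.
  have hconst : (‖x‖ₑ ^ 2 + ‖y‖ₑ ^ 2) * volume (Q s t) ≤ 9792 * B := by
    calc (‖x‖ₑ ^ 2 + ‖y‖ₑ ^ 2) * volume (Q s t) ≤ (‖x‖ₑ ^ 2 + ‖y‖ₑ ^ 2) * ENNReal.ofReal t := by
          gcongr
      _ = ENNReal.ofReal ((x ^ 2 + y ^ 2) * t) := by
          rw [ENNReal.ofReal_mul (by positivity), ENNReal.ofReal_add (by positivity)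
            (by positivity), ← sq_abs x, ← sq_abs y, ENNReal.ofReal_pow (abs_nonneg _),
            ENNReal.ofReal_pow (abs_nonneg _), ← Real.enorm_eq_ofReal_abs,
            ← Real.enorm_eq_ofReal_abs]
      _ ≤ ENNReal.ofReal (9792 * B.toReal) := ENNReal.ofReal_le_ofReal (by linarith)
      _ = 9792 * B := by
          rw [ENNReal.ofReal_mul (by norm_num), ENNReal.ofReal_toReal hBtop]
          simp
  have hsplit : ∀ r k l : ℝ, ‖r - k‖ₑ ^ 2 ≤ 2 * (‖r - l‖ₑ ^ 2 + ‖k - l‖ₑ ^ 2) := by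
    intro r k l
    refine le_trans ?_ (ENNReal.add_sq_le_two_mul _ _)
    gcongr
    calc ‖r - k‖ₑ = ‖(r - l) - (k - l)‖ₑ := by congr 1; ring
      _ ≤ _ := enorm_sub_le
  calc ∫⁻ p in Q s t, (‖g₁ p - interpX s t u‖ₑ ^ 2 + ‖g₂ p - interpY s t u‖ₑ ^ 2)
      ≤ ∫⁻ p in Q s t, 2 * ((‖g₁ p - b‖ₑ ^ 2 + ‖g₂ p - c‖ₑ ^ 2) + (‖x‖ₑ ^ 2 + ‖y‖ₑ ^ 2)) := by
        refine lintegral_mono fun p => (add_le_add (hsplit _ _ b) (hsplit _ _ c)).trans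
          (le_of_eq ?_)
        ring
    _ = 2 * ((∫⁻ p in Q s t, (‖g₁ p - b‖ₑ ^ 2 + ‖g₂ p - c‖ₑ ^ 2)) +
          (‖x‖ₑ ^ 2 + ‖y‖ₑ ^ 2) * volume (Q s t)) := by
        rw [lintegral_const_mul' _ _ (by simp), lintegral_add_right _ measurable_const,
          setLIntegral_const]
    _ ≤ 2 * (8 * B + 9792 * B) := by gcongr
    _ = _ := by ring

/-! ### From extended nonnegative integrals to the seminorms -/

theorem integral_sq_add_sq_eq_toReal {μ : Measure (ℝ × ℝ)} (hg₁ : AEStronglyMeasurable g₁ μ)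
    (hg₂ : AEStronglyMeasurable g₂ μ) :
    ∫ p, (g₁ p ^ 2 + g₂ p ^ 2) ∂μ = (∫⁻ p, (‖g₁ p‖ₑ ^ 2 + ‖g₂ p‖ₑ ^ 2) ∂μ).toReal := by
  rw [integral_eq_lintegral_of_nonneg_ae (Eventually.of_forall fun p => by positivity)
    (show AEStronglyMeasurable (fun p => g₁ p ^ 2 + g₂ p ^ 2) μ from (hg₁.pow 2).add (hg₂.pow 2))]
  congr 1
  refine lintegral_congr fun p => ?_
  rw [ENNReal.ofReal_add (by positivity) (by positivity), ← sq_abs (g₁ p), ← sq_abs (g₂ p),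
    ENNReal.ofReal_pow (abs_nonneg _), ENNReal.ofReal_pow (abs_nonneg _),
    ← Real.enorm_eq_ofReal_abs, ← Real.enorm_eq_ofReal_abs]

theorem integral_hessian_eq_toReal (h : HasWeakHessian Ω v g₁ g₂ h₁₁ h₁₂ h₂₁ h₂₂) :
    ∫ p in Ω, (h₁₁ p ^ 2 + h₁₂ p ^ 2 + h₂₁ p ^ 2 + h₂₂ p ^ 2) =
      (hessEnergy Ω h₁₁ h₁₂ h₂₁ h₂₂).toReal := by
  have hfin : ∀ {f g : ℝ × ℝ → ℝ}, MemLp f 2 (volume.restrict Ω) →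
      MemLp g 2 (volume.restrict Ω) → ∫⁻ p in Ω, (‖f p‖ₑ ^ 2 + ‖g p‖ₑ ^ 2) ≠ ⊤ := by
    intro f g hf hg
    rw [lintegral_add_left' (hf.1.enorm.pow_const 2)]
    simp [(lintegral_enorm_sq_lt_top hf).ne, (lintegral_enorm_sq_lt_top hg).ne]
  have h1 := h.memLp_fst_fst
  have h2 := h.memLp_fst_snd
  have h3 := h.memLp_snd_fst
  have h4 := h.memLp_snd_snd
  have hint : ∀ {f g : ℝ × ℝ → ℝ}, MemLp f 2 (volume.restrict Ω) →
      MemLp g 2 (volume.restrict Ω) →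
      Integrable (fun p => f p ^ 2 + g p ^ 2) (volume.restrict Ω) :=
    fun hf hg => hf.integrable_sq.add hg.integrable_sq
  rw [hessEnergy, ENNReal.toReal_add (hfin h1 h2) (hfin h3 h4),
    ← integral_sq_add_sq_eq_toReal h1.1 h2.1, ← integral_sq_add_sq_eq_toReal h3.1 h4.1,
    ← integral_add (hint h1 h2) (hint h3 h4)]
  congr 1
  ext p
  ring

end CutElement

end

theorem mainTheorem5 :
    ∃ C : ℝ, 0 < C ∧ ∀ s t : ℝ, 0 < s → s ≤ t → t < 1 →
      ∀ v : ℝ × ℝ → ℝ, CutElement.MemH2 (CutElement.Q s t) v →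
        (∃ u : ℝ × ℝ → ℝ, CutElement.IsContRep (CutElement.Q s t) v u) ∧
        ∀ u : ℝ × ℝ → ℝ, CutElement.IsContRep (CutElement.Q s t) v u →
          CutElement.MemH1 (CutElement.Q s t) (fun p => v p - CutElement.interpQ s t u p) ∧
          CutElement.semiH1 (CutElement.Q s t) (fun p => v p - CutElement.interpQ s t u p) ≤
            C * CutElement.semiH2 (CutElement.Q s t) v := by
  open CutElement in
  refine ⟨140, by norm_num, fun s t hs hst ht v hv => ?_⟩
  have h := hv.hasWeakHessian
  have hfin : volume (Q s t) ≠ ⊤ := ne_top_of_le_ne_top (by simp) (volume_Q_le hs hst ht)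
  refine ⟨h.exists_isContRep isOpen_Q (nonempty_Q hs hst) convex_Q
    (norm_sub_le_one_of_mem_Q hs hst ht) hfin, fun u hu => ?_⟩
  obtain ⟨a, ha⟩ := interpQ_eq_affineFun s t u
  have hw := h.sub_affineFun (isBounded_Q hs hst ht) a (interpX s t u) (interpY s t u)
  rw [ha]
  have hx : HasL2WeakDeriv (Q s t) ex _ := ⟨_, hw.memLp_fst, hw.deriv_fst⟩
  have hy : HasL2WeakDeriv (Q s t) ey _ := ⟨_, hw.memLp_snd, hw.deriv_snd⟩
  -- Membership in `H¹` guarantees that `semiH1` is not computed from the default value 0 of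
  -- `weakDeriv`.
  refine ⟨⟨hw.memLp, hx, hy⟩, ?_⟩
  -- `weakDeriv` is an arbitrary choice; uniqueness identifies it almost everywhere with the shifted
  -- gradient.
  have ex' := (weakDeriv_spec hx).2.unique isOpen_Q hw.deriv_fst
  have ey' := (weakDeriv_spec hy).2.unique isOpen_Q hw.deriv_snd
  have e1 := h.lintegral_sub_interp_le hs hst ht hu
  have hBtop := h.hessEnergy_ne_top
  have e2 := ENNReal.toReal_mono (by finiteness) e1
  rw [ENNReal.toReal_mul, ← integral_hessian_eq_toReal h,
    ← integral_sq_add_sq_eq_toReal hw.memLp_fst.1 hw.memLp_snd.1] at e2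
  unfold semiH1 semiH2
  rw [show (140 : ℝ) = Real.sqrt 19600 by
    rw [show (19600 : ℝ) = 140 ^ 2 by norm_num, Real.sqrt_sq (by norm_num)],
    ← Real.sqrt_mul (by norm_num)]
  apply Real.sqrt_le_sqrt
  refine le_trans (le_of_eq (integral_congr_ae ?_)) e2
  filter_upwards [ex', ey'] with p hp1 hp2
  rw [hp1, hp2]
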